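/- Let $n\ge 1$ and $0<|\varepsilon|<1$. On $\mathbb R\times\mathbb R^n$ use coordinates $x=(x^0,\bar x)$ and tangent coordinates $y=(y^0,\bar y)$. For an open interval $\emptyset\ne I\subseteq(0,\infty)$ put $D_I=\{x : |\bar x|\in I\}$. For a function $\phi$, a warped metric over $D_I$ given by $\phi$ is a Finsler metric $F$ over $D_I$ (smooth and positive for $y\neq0$, positively $1$-homogeneous in $y$, with $g_{AB}=\tfrac12[F^2]_{y^Ay^B}$ positive definite for $y\ne 0$) such that $$F(x,y)=|\bar y|\sqrt{\phi(z,\rho)},\qquad z=\frac{y^0}{|\bar y|},\quad \rho=|\bar x|,\qquad\text{whenever } \bar y\neq 0 .$$ Its spray coefficients are $G^C=\tfrac14 g^{CA}\big([F^2]_{y^Ax^B}y^B-[F^2]_{x^A}\big)$, its flag curvature tensor is $$K^C_B=2[G^C]_{x^B}-[G^C]_{x^Ay^B}y^A+2G^A[G^C]_{y^Ay^B}-[G^C]_{y^A}[G^A]_{y^B},$$ its Ricci curvature is $\mathrm{Ric}=K^A_A$, and $F$ is Ricci-flat if $\mathrm{Ric}(x,y)=0$ for all $x\in D_I$, $y\neq0$.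 $F$ is non-Riemannian if at no point $x\in D_I$ is $F(x,\cdot)^2$ a quadratic form. (1) Let $f,g\in C^\infty(I)$ and $$\phi(z,\rho)=\Big(\sqrt{e^{f(\rho)}z^2+e^{g(\rho)}}+\varepsilon e^{f(\rho)/2}z\Big)^2 .$$ Then a warped metric $F$ over $D_I$ given by $\phi$ exists, and every such $F$ is a non-Riemannian positive-definite Randers metric (the norm of a smooth Riemannian metric plus a smooth one-form whose length in that Riemannian metric is less than $1$). Moreover: - if $n\ge3$, $F$ is Ricci-flat if and only if $f$ is constant and either $g$ is constant or $g(\rho)=\ln(B\rho^{-4})$ for some $B>0$; - if $n=2$, $F$ is Ricci-flat if and only if $f$ is constant and $g(\rho)=\ln(B\rho^{C})$ for some $B>0$, $C\in\mathbb R$; - if $n=1$, $F$ is Ricci-flat if and only if $f$ is constant. (2) Consequently, each of the following $\phi$ gives a non-Riemannian Ricci-flat warped metric over $\mathbb R\times(\mathbb R^n\setminus\{0\})$, for all constants $A,B>0$, $C\in\mathbb R$ and all $g\in C^\infty(0,\infty)$: - $n\ge3$: $\phi=(\sqrt{Az^2+B}+\varepsilon\sqrt A\,z)^2$ and $\phi=(\sqrt{Az^2+B\rho^{-4}}+\varepsilon\sqrt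 A\,z)^2$; - $n=2$: $\phi=(\sqrt{Az^2+B\rho^{C}}+\varepsilon\sqrt A\,z)^2$; - $n=1$: $\phi=(\sqrt{Az^2+e^{g(\rho)}}+\varepsilon\sqrt A\,z)^2$. -/

import Mathlib

open Real
open scoped ContDiff

noncomputable section

namespace Finsler

/-! ## Finsler metrics on a domain of coordinate space

A point is `x : ι → ℝ`, a tangent vector at it is `y : ι → ℝ`, and a function on the tangent bundle
is a curried function of `(x, y)`. -/

section General

variable {ι : Type*} [Fintype ι] [DecidableEq ι]

/-- The partial derivative `∂H/∂x^A`. -/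
def pdx (A : ι) (H : (ι → ℝ) → (ι → ℝ) → ℝ) : (ι → ℝ) → (ι → ℝ) → ℝ :=
  fun x y => fderiv ℝ (fun x' => H x' y) x (Pi.single A 1)

/-- The partial derivative `∂H/∂y^A`. -/
def pdy (A : ι) (H : (ι → ℝ) → (ι → ℝ) → ℝ) : (ι → ℝ) → (ι → ℝ) → ℝ :=
  fun x y => fderiv ℝ (fun y' => H x y') y (Pi.single A 1)

/-- The function `F²`. -/
def sqr (F : (ι → ℝ) → (ι → ℝ) → ℝ) : (ι → ℝ) → (ι → ℝ) → ℝ :=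
  fun x y => F x y ^ 2

/-- The fundamental tensor `g_{AB} = ½ [F²]_{y^A y^B}`. -/
def fundamentalTensor (F : (ι → ℝ) → (ι → ℝ) → ℝ) (x y : ι → ℝ) : Matrix ι ι ℝ :=
  Matrix.of fun A B => (1 / 2) * pdy B (pdy A (sqr F)) x y

/-- `F` is a (smooth, positive-definite) Finsler metric over the domain `D`. -/
structure IsFinslerMetric (D : Set (ι → ℝ)) (F : (ι → ℝ) → (ι → ℝ) → ℝ) : Prop where
  smooth : ContDiffOn ℝ ∞ (fun p : (ι → ℝ) × (ι → ℝ) => F p.1 p.2) {p | p.1 ∈ D ∧ p.2 ≠ 0}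
  pos : ∀ x ∈ D, ∀ y, y ≠ 0 → 0 < F x y
  homogeneous : ∀ x ∈ D, ∀ y, ∀ c : ℝ, 0 < c → F x (c • y) = c * F x y
  stronglyConvex : ∀ x ∈ D, ∀ y, y ≠ 0 → (fundamentalTensor F x y).PosDef

/-- The spray coefficients `G^C = ¼ g^{CA} ([F²]_{y^A x^B} y^B - [F²]_{x^A})`. -/
def spray (F : (ι → ℝ) → (ι → ℝ) → ℝ) (C : ι) : (ι → ℝ) → (ι → ℝ) → ℝ :=
  fun x y => (1 / 4) * ∑ A, (fundamentalTensor F x y)⁻¹ C A *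
    ((∑ B, pdx B (pdy A (sqr F)) x y * y B) - pdx A (sqr F) x y)

/-- The flag curvature tensor, by Berwald's formula
`K^C_B = 2 [G^C]_{x^B} - [G^C]_{x^A y^B} y^A + 2 G^A [G^C]_{y^A y^B} - [G^C]_{y^A} [G^A]_{y^B}`. -/
def flagCurvature (F : (ι → ℝ) → (ι → ℝ) → ℝ) (C B : ι) (x y : ι → ℝ) : ℝ :=
  2 * pdx B (spray F C) x y
    - (∑ A, pdy B (pdx A (spray F C)) x y * y A)
    + 2 * (∑ A, spray F A x y * pdy B (pdy A (spray F C)) x y)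
    - ∑ A, pdy A (spray F C) x y * pdy B (spray F A) x y

/-- The Ricci curvature `Ric = K^A_A`. -/
def ricci (F : (ι → ℝ) → (ι → ℝ) → ℝ) (x y : ι → ℝ) : ℝ :=
  ∑ A, flagCurvature F A A x y

/-- `Ric = 0` at all nonzero tangent vectors over `D`. -/
def IsRicciFlat (D : Set (ι → ℝ)) (F : (ι → ℝ) → (ι → ℝ) → ℝ) : Prop :=
  ∀ x ∈ D, ∀ y, y ≠ 0 → ricci F x y = 0

/-- `F` is Riemannian at the point `x`: its square is a quadratic form on the tangent space. -/
def IsRiemannianAt (F : (ι → ℝ) → (ι → ℝ) → ℝ) (x : ι → ℝ) : Prop :=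
  ∃ q : QuadraticForm ℝ (ι → ℝ), ∀ y, F x y ^ 2 = q y

/-- `F` is a positive-definite Randers metric over `D`: the sum of the norm of a smooth Riemannian
metric `a` and a smooth one-form `b` whose length with respect to `a` is less than one. -/
def IsRandersMetric (D : Set (ι → ℝ)) (F : (ι → ℝ) → (ι → ℝ) → ℝ) : Prop :=
  ∃ (a : (ι → ℝ) → Matrix ι ι ℝ) (b : (ι → ℝ) → ι → ℝ),
    (∀ A B, ContDiffOn ℝ ∞ (fun x => a x A B) D) ∧
    (∀ A, ContDiffOn ℝ ∞ (fun x => b x A) D) ∧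
    (∀ x ∈ D, (a x).PosDef) ∧
    (∀ x ∈ D, dotProduct (b x) ((a x)⁻¹.mulVec (b x)) < 1) ∧
    ∀ x ∈ D, ∀ y, F x y = √(dotProduct y ((a x).mulVec y)) + dotProduct (b x) y

end General

/-! ## The warped metrics `F = α √φ(z, ρ)` on `ℝ × ℝⁿ`

The coordinates are `x = (x⁰, x̄)` and `y = (y⁰, ȳ)`, indexed by `Fin (n + 1)`. -/

/-- The Euclidean norm of the last `n` coordinates: `|v̄|` for `v = (v⁰, v̄)`. -/
def spatialNorm {n : ℕ} (v : Fin (n + 1) → ℝ) : ℝ :=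
  √(∑ i : Fin n, v i.succ ^ 2)

/-- The set of points `(x⁰, x̄)` of `ℝ × ℝⁿ` with `|x̄| ∈ I`. -/
def shell (n : ℕ) (I : Set ℝ) : Set (Fin (n + 1) → ℝ) :=
  {x | spatialNorm x ∈ I}

/-- `F` is a Finsler metric over `{|x̄| ∈ I}` that is given by `F = α √φ(z, ρ)`, where `α = |ȳ|`,
`z = y⁰ / |ȳ|` and `ρ = |x̄|`, wherever `ȳ ≠ 0`. By continuity, `φ` determines the
values of `F` at the vectors with `ȳ = 0`. -/
def IsWarpedMetric (n : ℕ) (I : Set ℝ) (φ : ℝ → ℝ → ℝ)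
    (F : (Fin (n + 1) → ℝ) → (Fin (n + 1) → ℝ) → ℝ) : Prop :=
  IsFinslerMetric (shell n I) F ∧
    ∀ x ∈ shell n I, ∀ y, spatialNorm y ≠ 0 →
      F x y = spatialNorm y * √(φ (y 0 / spatialNorm y) (spatialNorm x))

/-- The ansatz `φ(z, ρ) = (√(e^{f(ρ)} z² + e^{g(ρ)}) + ε e^{f(ρ)/2} z)²`. -/
def randersPhi (ε : ℝ) (f g : ℝ → ℝ) (z ρ : ℝ) : ℝ :=
  (√(exp (f ρ) * z ^ 2 + exp (g ρ)) + ε * exp (f ρ / 2) * z) ^ 2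

/-- `φ` defines a Ricci-flat Finsler metric over `{|x̄| ∈ I}` that is nowhere Riemannian. -/
def IsNonRiemannianRicciFlatSolution (n : ℕ) (I : Set ℝ) (φ : ℝ → ℝ → ℝ) : Prop :=
  ∃ F, IsWarpedMetric n I φ F ∧ IsRicciFlat (shell n I) F ∧ ∀ x ∈ shell n I, ¬ IsRiemannianAt F x

end Finsler

end

/-!
With `a² = e^f` and `b = e^g` the metric of the ansatz is the Randers metric `F = α + ε a y⁰` with
`α² = a² (y⁰)² + b |ȳ|²`; the one-form `ε a dx⁰` has constant length `|ε| < 1`, which gives strong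
convexity, and it makes `F` non-reversible, hence non-Riemannian. A warped metric given by `φ`
agrees with this `F` also where `ȳ = 0`, by continuity (`IsWarpedMetric.eq_ansatz`). The
coefficients are treated as functions of `s = |x̄|²`, so that their derivatives in `x̄` involve no
square roots.

The spray has an explicit formula, which is verified by substitution into the Euler–Lagrange
equations of `F²` (`IsRadialRanders.spray_eq`, `eulerLagrange_identity`); all terms with `ε`
contain the factor `a'`. Second-order jets (`HasJet`) carry out the differentiations.

That `a` must be constant is seen in the two directions `± ∂/∂x⁰` alone: the quotients
`Ric / (1 ± ε)` there differ by a nonzero multiple of `ε s a'² / b`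
(`IsRadialRanders.deriv_eq_zero_of_ricci_eq_zero`). Once `a` is constant, the spray is that of the
product of a line with the conformally flat metric `b |ȳ|²`, and with `Γ = b' / b` the Ricci
curvature is an explicit quadratic form in `⟨x̄, ȳ⟩` and `|ȳ|`
(`IsRadialRanders.ricci_eq_of_deriv_eq_zero`). It vanishes identically if `n = 1`. For `n ≥ 2` its
radial value shows that `s Γ` is a constant `c`, i.e. that `b` is a multiple of `s ^ c`, and then
its vanishing amounts to `(n - 2) c (c + 2) = 0`; this is `isRicciFlat_iff`, with `C = 2 c`.
-/

namespace Finsler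

/-! ### Second-order jets of real functions along two directions -/

section Jet

variable {X : Type*} [NormedAddCommGroup X] [NormedSpace ℝ X]

/-- `H` is `C²` at `p`, and the numbers `h`, `hu`, `hv`, `huv` are the value of `H` at `p`, its
derivatives in the directions `u` and `v`, and its mixed second derivative, first in the direction
`u` and then in the direction `v`. -/
structure HasJet (H : X → ℝ) (p u v : X) (h hu hv huv : ℝ) : Prop where
  smooth : ContDiffAt ℝ 2 H p
  val : H p = h
  du : fderiv ℝ H p u = hu
  dv : fderiv ℝ H p v = hv
  duv : fderiv ℝ (fun q => fderiv ℝ H q u) p v = huv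

theorem eventually_differentiableAt_of_contDiffAt_two {H : X → ℝ} {p : X}
    (hH : ContDiffAt ℝ 2 H p) : ∀ᶠ q in nhds p, DifferentiableAt ℝ H q := by
  have h1 : ContDiffAt ℝ 1 H p := hH.of_le (by norm_num)
  filter_upwards [h1.eventually (by simp)] with q hq
  exact hq.differentiableAt (by simp)

theorem differentiableAt_fderiv_apply {H : X → ℝ} {p : X} (hH : ContDiffAt ℝ 2 H p) (u : X) :
    DifferentiableAt ℝ (fun q => fderiv ℝ H q u) p := by
  have h1 : ContDiffAt ℝ 1 (fderiv ℝ H) p := hH.fderiv_right (by norm_num)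
  exact (h1.differentiableAt (by simp)).clm_apply (differentiableAt_const u)

namespace HasJet

variable {H K : X → ℝ} {p u v : X} {h hu hv huv k ku kv kuv : ℝ}

/-- Replaces the four values of a jet by equal ones. -/
theorem cast {h' hu' hv' huv' : ℝ} (J : HasJet H p u v h hu hv huv) (e : h = h') (eu : hu = hu')
    (ev : hv = hv') (euv : huv = huv') : HasJet H p u v h' hu' hv' huv' := by
  subst e eu ev euv; exact J

theorem congr (J : HasJet H p u v h hu hv huv) (e : K =ᶠ[nhds p] H) :
    HasJet K p u v h hu hv huv where
  smooth := J.smooth.congr_of_eventuallyEq e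
  val := e.eq_of_nhds.trans J.val
  du := by rw [e.fderiv_eq]; exact J.du
  dv := by rw [e.fderiv_eq]; exact J.dv
  duv := by
    have : (fun q => fderiv ℝ K q u) =ᶠ[nhds p] fun q => fderiv ℝ H q u := by
      filter_upwards [e.eventuallyEq_nhds] with q hq
      rw [hq.fderiv_eq]
    rw [this.fderiv_eq]; exact J.duv

theorem const (c : ℝ) (p u v : X) : HasJet (fun _ : X => c) p u v c 0 0 0 := by
  refine ⟨contDiffAt_const, rfl, ?_, ?_, ?_⟩ <;> simp

theorem clm (L : X →L[ℝ] ℝ) (p u v : X) : HasJet (fun q => L q) p u v (L p) (L u) (L v) 0 := by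
  refine ⟨L.contDiff.contDiffAt, rfl, ?_, ?_, ?_⟩ <;> simp

theorem add (J : HasJet H p u v h hu hv huv) (J' : HasJet K p u v k ku kv kuv) :
    HasJet (fun q => H q + K q) p u v (h + k) (hu + ku) (hv + kv) (huv + kuv) := by
  have e : ∀ᶠ q in nhds p, ∀ w, fderiv ℝ (fun q => H q + K q) q w
      = fderiv ℝ H q w + fderiv ℝ K q w := by
    filter_upwards [eventually_differentiableAt_of_contDiffAt_two J.smooth,
      eventually_differentiableAt_of_contDiffAt_two J'.smooth] with q h1 h2 w
    rw [fderiv_fun_add h1 h2]; rfl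
  refine ⟨J.smooth.add J'.smooth, by rw [J.val, J'.val], ?_, ?_, ?_⟩
  · rw [e.self_of_nhds, J.du, J'.du]
  · rw [e.self_of_nhds, J.dv, J'.dv]
  · have : (fun q => fderiv ℝ (fun q => H q + K q) q u) =ᶠ[nhds p]
        fun q => fderiv ℝ H q u + fderiv ℝ K q u := e.mono fun q hq => hq u
    rw [this.fderiv_eq, fderiv_fun_add (differentiableAt_fderiv_apply J.smooth u)
      (differentiableAt_fderiv_apply J'.smooth u), ← J.duv, ← J'.duv]; rfl

theorem mul (J : HasJet H p u v h hu hv huv) (J' : HasJet K p u v k ku kv kuv) :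
    HasJet (fun q => H q * K q) p u v (h * k) (hu * k + h * ku) (hv * k + h * kv)
      (huv * k + hu * kv + hv * ku + h * kuv) := by
  have e : ∀ᶠ q in nhds p, ∀ w, fderiv ℝ (fun q => H q * K q) q w
      = H q * fderiv ℝ K q w + K q * fderiv ℝ H q w := by
    filter_upwards [eventually_differentiableAt_of_contDiffAt_two J.smooth,
      eventually_differentiableAt_of_contDiffAt_two J'.smooth] with q h1 h2 w
    rw [fderiv_fun_mul h1 h2]; rfl
  refine ⟨J.smooth.mul J'.smooth, by rw [J.val, J'.val], ?_, ?_, ?_⟩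
  · rw [e.self_of_nhds, J.du, J'.du, J.val, J'.val]; ring
  · rw [e.self_of_nhds, J.dv, J'.dv, J.val, J'.val]; ring
  · have : (fun q => fderiv ℝ (fun q => H q * K q) q u) =ᶠ[nhds p]
        fun q => H q * fderiv ℝ K q u + K q * fderiv ℝ H q u := e.mono fun q hq => hq u
    have d1 := J.smooth.differentiableAt (by simp)
    have d2 := J'.smooth.differentiableAt (by simp)
    have d3 := differentiableAt_fderiv_apply J.smooth u
    have d4 := differentiableAt_fderiv_apply J'.smooth u
    rw [this.fderiv_eq, fderiv_fun_add (d1.fun_mul d4) (d2.fun_mul d3), fderiv_fun_mul d1 d4,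
      fderiv_fun_mul d2 d3]
    simp only [add_apply, smul_apply, smul_eq_mul,
      J.val, J'.val, J.du, J'.du, J.dv, J'.dv, J.duv, J'.duv]
    ring

theorem const_mul (c : ℝ) (J : HasJet H p u v h hu hv huv) :
    HasJet (fun q => c * H q) p u v (c * h) (c * hu) (c * hv) (c * huv) :=
  ((const c p u v).mul J).cast rfl (by ring) (by ring) (by ring)

theorem sub (J : HasJet H p u v h hu hv huv) (J' : HasJet K p u v k ku kv kuv) :
    HasJet (fun q => H q - K q) p u v (h - k) (hu - ku) (hv - kv) (huv - kuv) :=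
  ((J.add (J'.const_mul (-1))).cast (by ring) (by ring) (by ring) (by ring)).congr
    (Filter.Eventually.of_forall fun q => by ring)

theorem comp {φ : ℝ → ℝ} (hφ : ContDiffAt ℝ 2 φ h) (J : HasJet H p u v h hu hv huv) :
    HasJet (fun q => φ (H q)) p u v (φ h) (deriv φ h * hu) (deriv φ h * hv)
      (deriv (deriv φ) h * hu * hv + deriv φ h * huv) := by
  have hφ' : ContDiffAt ℝ 2 φ (H p) := J.val ▸ hφ
  have e : ∀ᶠ q in nhds p, ∀ w, fderiv ℝ (fun q => φ (H q)) q w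
      = deriv φ (H q) * fderiv ℝ H q w := by
    filter_upwards [eventually_differentiableAt_of_contDiffAt_two J.smooth,
      J.smooth.continuousAt.eventually
        (eventually_differentiableAt_of_contDiffAt_two hφ')] with q h1 h2 w
    have : HasFDerivAt (fun q => φ (H q)) (deriv φ (H q) • fderiv ℝ H q) q :=
      h2.hasDerivAt.comp_hasFDerivAt q h1.hasFDerivAt
    rw [this.fderiv]; rfl
  refine ⟨hφ'.comp p J.smooth, by rw [J.val], ?_, ?_, ?_⟩
  · rw [e.self_of_nhds, J.du, J.val]
  · rw [e.self_of_nhds, J.dv, J.val]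
  · have : (fun q => fderiv ℝ (fun q => φ (H q)) q u) =ᶠ[nhds p]
        fun q => deriv φ (H q) * fderiv ℝ H q u := e.mono fun q hq => hq u
    have d1 := J.smooth.differentiableAt (by simp)
    have d3 := differentiableAt_fderiv_apply J.smooth u
    have d0 : DifferentiableAt ℝ (deriv φ) (H p) := differentiableAt_fderiv_apply hφ' 1
    have d2 : HasFDerivAt (fun q => deriv φ (H q)) (deriv (deriv φ) (H p) • fderiv ℝ H p) p :=
      d0.hasDerivAt.comp_hasFDerivAt p d1.hasFDerivAt
    rw [this.fderiv_eq, fderiv_fun_mul d2.differentiableAt d3, d2.fderiv]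
    simp only [add_apply, smul_apply, smul_eq_mul,
      J.val, J.du, J.dv, J.duv]
    ring

theorem inv (J : HasJet H p u v h hu hv huv) (h0 : h ≠ 0) :
    HasJet (fun q => (H q)⁻¹) p u v h⁻¹ (-hu / h ^ 2) (-hv / h ^ 2)
      (2 * hu * hv / h ^ 3 - huv / h ^ 2) := by
  have d1 : deriv (fun r : ℝ => r⁻¹) h = -(h ^ 2)⁻¹ := deriv_inv
  have d2 : deriv (deriv fun r : ℝ => r⁻¹) h = 2 / h ^ 3 := by
    rw [deriv_inv']
    have := ((hasDerivAt_pow 2 h).inv (pow_ne_zero 2 h0)).neg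
    refine this.deriv.trans ?_
    field_simp
    norm_num
    ring
  refine (J.comp (φ := fun r => r⁻¹) (contDiffAt_inv ℝ h0)).cast rfl ?_ ?_ ?_
  · rw [d1]; field_simp
  · rw [d1]; field_simp
  · rw [d1, d2]; field_simp; ring

theorem sqrt {r : ℝ} (J : HasJet H p u v h hu hv huv) (hr : 0 < r) (e : r ^ 2 = h) :
    HasJet (fun q => √(H q)) p u v r (hu / (2 * r)) (hv / (2 * r))
      (huv / (2 * r) - hu * hv / (4 * r ^ 3)) := by
  have h0 : 0 < h := e ▸ pow_pos hr 2
  have er : √h = r := by rw [← e, Real.sqrt_sq hr.le]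
  have d1 : ∀ x : ℝ, 0 < x → HasDerivAt (fun t => √t) (1 / (2 * √x)) x :=
    fun x hx => Real.hasDerivAt_sqrt hx.ne'
  have d2 : deriv (deriv fun t => √t) h = -1 / (4 * r ^ 3) := by
    have : deriv (fun t => √t) =ᶠ[nhds h] fun x => 1 / (2 * √x) := by
      filter_upwards [lt_mem_nhds h0] with x hx
      exact (d1 x hx).deriv
    rw [this.deriv_eq]
    have := ((d1 h h0).const_mul 2).inv (by rw [er]; positivity)
    simp only [one_div]
    refine this.deriv.trans ?_
    rw [er]; field_simp; norm_num
  refine (J.comp (φ := fun r => √r) (Real.contDiffAt_sqrt h0.ne')).cast er ?_ ?_ ?_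
  · rw [(d1 h h0).deriv, er]; field_simp
  · rw [(d1 h h0).deriv, er]; field_simp
  · rw [(d1 h h0).deriv, d2, er]; field_simp; ring

theorem div (J : HasJet H p u v h hu hv huv) (J' : HasJet K p u v k ku kv kuv) (k0 : k ≠ 0) :
    HasJet (fun q => H q / K q) p u v (h / k) (hu / k - h * ku / k ^ 2) (hv / k - h * kv / k ^ 2)
      (huv / k - hu * kv / k ^ 2 - hv * ku / k ^ 2 + h * (2 * ku * kv / k ^ 3 - kuv / k ^ 2)) :=
  ((J.mul (J'.inv k0)).cast (by field_simp) (by field_simp; ring) (by field_simp; ring)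
    (by field_simp; ring)).congr
    (Filter.Eventually.of_forall fun q => by simp [div_eq_mul_inv])

end HasJet

end Jet

/-! ### Coordinate formulas in terms of directional derivatives on the tangent bundle -/

section Coordinates

variable {ι : Type*} [Fintype ι] [DecidableEq ι]

/-- A curried function on the tangent bundle as a function of the pair `(x, y)`. -/
def onPairs (H : (ι → ℝ) → (ι → ℝ) → ℝ) : (ι → ℝ) × (ι → ℝ) → ℝ := fun q => H q.1 q.2

/-- The mixed second derivative of `H` at `p`, first in the direction `u` and then in the
direction `v`. -/
noncomputable def secondDeriv {X : Type*} [NormedAddCommGroup X] [NormedSpace ℝ X] (H : X → ℝ)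
    (p u v : X) : ℝ :=
  fderiv ℝ (fun q => fderiv ℝ H q u) p v

theorem secondDeriv_eq {X : Type*} [NormedAddCommGroup X] [NormedSpace ℝ X] {H : X → ℝ} {p : X}
    (hH : ContDiffAt ℝ 2 H p) (u v : X) :
    secondDeriv H p u v = fderiv ℝ (fderiv ℝ H) p v u := by
  have h1 : ContDiffAt ℝ 1 (fderiv ℝ H) p := hH.fderiv_right (by norm_num)
  have h2 := (h1.differentiableAt (by simp)).hasFDerivAt
  have := (h2.clm_apply (hasFDerivAt_const u p)).fderiv
  unfold secondDeriv
  rw [this]; simp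

variable {H : (ι → ℝ) → (ι → ℝ) → ℝ} {x y : ι → ℝ}

theorem pdx_eq_fderiv (hH : DifferentiableAt ℝ (onPairs H) (x, y)) (A : ι) :
    pdx A H x y = fderiv ℝ (onPairs H) (x, y) (Pi.single A 1, 0) := by
  have h1 : HasFDerivAt (fun x' => (x', y)) (ContinuousLinearMap.inl ℝ (ι → ℝ) (ι → ℝ)) x :=
    hasFDerivAt_prodMk_left x y
  have h2 := HasFDerivAt.comp x (f := fun x' => (x', y)) hH.hasFDerivAt h1
  have h3 : HasFDerivAt (fun x' => H x' y) _ x := h2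
  unfold pdx
  rw [h3.fderiv]; simp

theorem pdy_eq_fderiv (hH : DifferentiableAt ℝ (onPairs H) (x, y)) (A : ι) :
    pdy A H x y = fderiv ℝ (onPairs H) (x, y) (0, Pi.single A 1) := by
  have h1 : HasFDerivAt (fun y' => (x, y')) (ContinuousLinearMap.inr ℝ (ι → ℝ) (ι → ℝ)) y :=
    hasFDerivAt_prodMk_right x y
  have h2 := HasFDerivAt.comp y (f := fun y' => (x, y')) hH.hasFDerivAt h1
  have h3 : HasFDerivAt (fun y' => H x y') _ y := h2
  unfold pdy
  rw [h3.fderiv]; simp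

theorem onPairs_pdx_eventuallyEq (hH : ContDiffAt ℝ 2 (onPairs H) (x, y)) (A : ι) :
    onPairs (pdx A H) =ᶠ[nhds (x, y)] fun q => fderiv ℝ (onPairs H) q (Pi.single A 1, 0) := by
  filter_upwards [eventually_differentiableAt_of_contDiffAt_two hH] with q hq
  exact pdx_eq_fderiv hq A

theorem onPairs_pdy_eventuallyEq (hH : ContDiffAt ℝ 2 (onPairs H) (x, y)) (A : ι) :
    onPairs (pdy A H) =ᶠ[nhds (x, y)] fun q => fderiv ℝ (onPairs H) q (0, Pi.single A 1) := by
  filter_upwards [eventually_differentiableAt_of_contDiffAt_two hH] with q hq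
  exact pdy_eq_fderiv hq A

theorem pdy_pdy_eq (hH : ContDiffAt ℝ 2 (onPairs H) (x, y)) (A B : ι) :
    pdy B (pdy A H) x y = secondDeriv (onPairs H) (x, y) (0, Pi.single A 1) (0, Pi.single B 1) := by
  have e := onPairs_pdy_eventuallyEq hH A
  rw [pdy_eq_fderiv (((differentiableAt_fderiv_apply hH _).congr_of_eventuallyEq e)), e.fderiv_eq]
  rfl

theorem pdx_pdy_eq (hH : ContDiffAt ℝ 2 (onPairs H) (x, y)) (A B : ι) :
    pdx B (pdy A H) x y = secondDeriv (onPairs H) (x, y) (0, Pi.single A 1) (Pi.single B 1, 0) := by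
  have e := onPairs_pdy_eventuallyEq hH A
  rw [pdx_eq_fderiv (((differentiableAt_fderiv_apply hH _).congr_of_eventuallyEq e)), e.fderiv_eq]
  rfl

theorem pdy_pdx_eq (hH : ContDiffAt ℝ 2 (onPairs H) (x, y)) (A B : ι) :
    pdy B (pdx A H) x y = secondDeriv (onPairs H) (x, y) (Pi.single A 1, 0) (0, Pi.single B 1) := by
  have e := onPairs_pdx_eventuallyEq hH A
  rw [pdy_eq_fderiv (((differentiableAt_fderiv_apply hH _).congr_of_eventuallyEq e)), e.fderiv_eq]
  rfl

theorem sum_smul_single_fst (z : ι → ℝ) :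
    ∑ A, z A • ((Pi.single A 1, 0) : (ι → ℝ) × (ι → ℝ)) = (z, 0) := by
  ext i <;> simp [Prod.fst_sum, Prod.snd_sum, Finset.sum_apply, Pi.single_apply]

theorem sum_smul_single_snd (z : ι → ℝ) :
    ∑ A, z A • ((0, Pi.single A 1) : (ι → ℝ) × (ι → ℝ)) = (0, z) := by
  ext i <;> simp [Prod.fst_sum, Prod.snd_sum, Finset.sum_apply, Pi.single_apply]

theorem sum_linear_single_fst (L : (ι → ℝ) × (ι → ℝ) →L[ℝ] ℝ) (z : ι → ℝ) :
    ∑ A, L (Pi.single A 1, 0) * z A = L (z, 0) := by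
  rw [← sum_smul_single_fst z, map_sum]
  exact Finset.sum_congr rfl fun A _ => by rw [map_smul, smul_eq_mul, mul_comm]

theorem sum_linear_single_snd (L : (ι → ℝ) × (ι → ℝ) →L[ℝ] ℝ) (z : ι → ℝ) :
    ∑ A, L (0, Pi.single A 1) * z A = L (0, z) := by
  rw [← sum_smul_single_snd z, map_sum]
  exact Finset.sum_congr rfl fun A _ => by rw [map_smul, smul_eq_mul, mul_comm]

/-- The spray coefficients are the solution `G` of the Euler–Lagrange equations
`2 [F²]_{y^A y^C} G^C - [F²]_{y^A x^B} y^B + [F²]_{x^A} = 0`. -/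
theorem spray_eq_of_eulerLagrange {F : (ι → ℝ) → (ι → ℝ) → ℝ}
    (hF : ContDiffAt ℝ 2 (onPairs (sqr F)) (x, y)) (hg : (fundamentalTensor F x y).PosDef)
    (G : ι → ℝ)
    (hG : ∀ A : ι, secondDeriv (onPairs (sqr F)) (x, y) (0, Pi.single A 1) (-y, (2 : ℝ) • G)
      + fderiv ℝ (onPairs (sqr F)) (x, y) (Pi.single A 1, 0) = 0) (C : ι) :
    spray F C x y = G C := by
  set M := fundamentalTensor F x y with hM
  have hdet : IsUnit M.det := isUnit_iff_ne_zero.mpr hg.det_pos.ne'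
  have hR : ∀ A, (∑ B, pdx B (pdy A (sqr F)) x y * y B) - pdx A (sqr F) x y
      = (M.mulVec ((4 : ℝ) • G)) A := by
    intro A
    set T := fderiv ℝ (fderiv ℝ (onPairs (sqr F))) (x, y) with hT
    have e1 : ∑ B, pdx B (pdy A (sqr F)) x y * y B = T (y, 0) (0, Pi.single A 1) := by
      simp_rw [pdx_pdy_eq hF, secondDeriv_eq hF]
      exact sum_linear_single_fst (T.flip (0, Pi.single A 1)) y
    have e2 : (M.mulVec ((4 : ℝ) • G)) A = 2 * T (0, G) (0, Pi.single A 1) := by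
      have h := sum_linear_single_snd (T.flip (0, Pi.single A 1)) G
      simp only [ContinuousLinearMap.flip_apply] at h
      rw [← h, Finset.mul_sum]
      refine Finset.sum_congr rfl fun B _ => ?_
      simp only [hM, fundamentalTensor, Matrix.of_apply, pdy_pdy_eq hF, secondDeriv_eq hF,
        Pi.smul_apply, smul_eq_mul, ← hT]
      ring
    have e3 := hG A
    have e4 : ((-y, (2 : ℝ) • G) : (ι → ℝ) × (ι → ℝ)) = (2 : ℝ) • (0, G) - (y, 0) := by
      ext i <;> simp
    rw [secondDeriv_eq hF, ← hT, e4, map_sub, map_smul, sub_apply, smul_apply, smul_eq_mul] at e3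
    rw [e1, e2, pdx_eq_fderiv (hF.differentiableAt (by simp))]
    linarith
  have key : spray F C x y = (1 / 4) * (M⁻¹.mulVec (M.mulVec ((4 : ℝ) • G))) C := by
    unfold spray
    simp only [Matrix.mulVec, dotProduct] at hR ⊢
    simp only [hR, ← hM]
  rw [key, Matrix.mulVec_mulVec, Matrix.nonsing_inv_mul _ hdet, Matrix.one_mulVec]
  simp

/-- Berwald's formula in terms of directional derivatives: its three second-order terms combine into
one derivative along the (sign-reversed) geodesic field `(-y, 2 G)`. -/
theorem flagCurvature_eq {F : (ι → ℝ) → (ι → ℝ) → ℝ} {G : ι → ℝ}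
    (hS : ∀ C, ContDiffAt ℝ 2 (onPairs (spray F C)) (x, y)) (hG : ∀ C, spray F C x y = G C)
    (C B : ι) :
    flagCurvature F C B x y = 2 * fderiv ℝ (onPairs (spray F C)) (x, y) (Pi.single B 1, 0)
      + secondDeriv (onPairs (spray F C)) (x, y) (-y, (2 : ℝ) • G) (0, Pi.single B 1)
      - ∑ A, fderiv ℝ (onPairs (spray F C)) (x, y) (0, Pi.single A 1)
          * fderiv ℝ (onPairs (spray F A)) (x, y) (0, Pi.single B 1) := by
  have hd : ∀ C, DifferentiableAt ℝ (onPairs (spray F C)) (x, y) := fun C =>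
    (hS C).differentiableAt (by simp)
  set T := fderiv ℝ (fderiv ℝ (onPairs (spray F C))) (x, y) with hT
  have e1 : ∑ A, pdy B (pdx A (spray F C)) x y * y A = T (0, Pi.single B 1) (y, 0) := by
    simp_rw [pdy_pdx_eq (hS C), secondDeriv_eq (hS C)]
    exact sum_linear_single_fst (T (0, Pi.single B 1)) y
  have e2 : ∑ A, spray F A x y * pdy B (pdy A (spray F C)) x y
      = T (0, Pi.single B 1) (0, G) := by
    simp_rw [pdy_pdy_eq (hS C), secondDeriv_eq (hS C), hG, mul_comm (G _)]
    exact sum_linear_single_snd (T (0, Pi.single B 1)) G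
  have e4 : ((-y, (2 : ℝ) • G) : (ι → ℝ) × (ι → ℝ)) = (2 : ℝ) • (0, G) - (y, 0) := by
    ext i <;> simp
  unfold flagCurvature
  rw [e1, e2, secondDeriv_eq (hS C), ← hT, e4, map_sub, map_smul, smul_eq_mul]
  simp only [pdx_eq_fderiv (hd _), pdy_eq_fderiv (hd _)]
  ring

end Coordinates

/-! ### The Randers ansatz and its fundamental tensor -/

section Metric

/-- Pairs `(x, y)` of vectors of `ℝ × ℝⁿ`: the points of the tangent bundle, and also the directions
tangent to it. -/
abbrev Tangent (n : ℕ) : Type := (Fin (n + 1) → ℝ) × (Fin (n + 1) → ℝ)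

variable {n : ℕ}

/-- The Euclidean inner product `⟨ū, v̄⟩` of the last `n` coordinates. -/
def sdot (u v : Fin (n + 1) → ℝ) : ℝ := ∑ i : Fin n, u i.succ * v i.succ

theorem sdot_def (u v : Fin (n + 1) → ℝ) : sdot u v = ∑ i : Fin n, u i.succ * v i.succ := rfl

theorem sdot_comm (u v : Fin (n + 1) → ℝ) : sdot u v = sdot v u :=
  Finset.sum_congr rfl fun _ _ => mul_comm _ _

theorem sdot_add_left (u v w : Fin (n + 1) → ℝ) : sdot (u + v) w = sdot u w + sdot v w := by
  simp [sdot, add_mul, Finset.sum_add_distrib]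

theorem sdot_smul_left (c : ℝ) (u v : Fin (n + 1) → ℝ) : sdot (c • u) v = c * sdot u v := by
  simp [sdot, Finset.mul_sum, mul_assoc]

theorem sdot_smul_right (c : ℝ) (u v : Fin (n + 1) → ℝ) : sdot u (c • v) = c * sdot u v := by
  rw [sdot_comm, sdot_smul_left, sdot_comm]

@[simp] theorem sdot_zero_left (v : Fin (n + 1) → ℝ) : sdot 0 v = 0 := by simp [sdot]

@[simp] theorem sdot_zero_right (v : Fin (n + 1) → ℝ) : sdot v 0 = 0 := by simp [sdot]

@[simp] theorem sdot_neg_right (u v : Fin (n + 1) → ℝ) : sdot u (-v) = -sdot u v := by simp [sdot]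

@[simp] theorem sdot_single_zero (u : Fin (n + 1) → ℝ) (c : ℝ) :
    sdot u (Pi.single 0 c) = 0 := by
  simp [sdot]

@[simp] theorem sdot_single_succ (u : Fin (n + 1) → ℝ) (i : Fin n) (c : ℝ) :
    sdot u (Pi.single i.succ c) = u i.succ * c := by
  simp [sdot, Pi.single_apply]

@[simp] theorem sdot_single_zero_left (u : Fin (n + 1) → ℝ) (c : ℝ) :
    sdot (Pi.single 0 c) u = 0 := by
  rw [sdot_comm, sdot_single_zero]

theorem sdot_self_nonneg (u : Fin (n + 1) → ℝ) : 0 ≤ sdot u u :=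
  Finset.sum_nonneg fun _ _ => mul_self_nonneg _

theorem sdot_self_eq_zero {u : Fin (n + 1) → ℝ} (h : sdot u u = 0) (i : Fin n) : u i.succ = 0 := by
  have := (Finset.sum_eq_zero_iff_of_nonneg (fun _ _ => mul_self_nonneg _)).mp h i
    (Finset.mem_univ i)
  exact mul_self_eq_zero.mp this

theorem spatialNorm_eq (v : Fin (n + 1) → ℝ) : spatialNorm v = √(sdot v v) := by
  simp [spatialNorm, sdot, pow_two]

variable {X : Type*} [NormedAddCommGroup X] [NormedSpace ℝ X]

theorem HasJet.sum {κ : Type*} (S : Finset κ) {H : κ → X → ℝ} {p u v : X} {h hu hv huv : κ → ℝ}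
    (J : ∀ i, HasJet (H i) p u v (h i) (hu i) (hv i) (huv i)) :
    HasJet (fun q => ∑ i ∈ S, H i q) p u v (∑ i ∈ S, h i) (∑ i ∈ S, hu i) (∑ i ∈ S, hv i)
      (∑ i ∈ S, huv i) := by
  classical
  induction S using Finset.induction_on with
  | empty => simpa using HasJet.const 0 p u v
  | insert i S hi ih =>
    simp only [Finset.sum_insert hi]
    exact (J i).add ih

theorem HasJet.sdot (L M : X →L[ℝ] (Fin (n + 1) → ℝ)) (p u v : X) :
    HasJet (fun q => Finsler.sdot (L q) (M q)) p u v (Finsler.sdot (L p) (M p))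
      (Finsler.sdot (L u) (M p) + Finsler.sdot (L p) (M u))
      (Finsler.sdot (L v) (M p) + Finsler.sdot (L p) (M v))
      (Finsler.sdot (L u) (M v) + Finsler.sdot (L v) (M u)) := by
  simp only [Finsler.sdot, ← Finset.sum_add_distrib]
  have hc : ∀ (N : X →L[ℝ] (Fin (n + 1) → ℝ)) (i : Fin n),
      HasJet (fun q => N q i.succ) p u v (N p i.succ) (N u i.succ) (N v i.succ) 0 := fun N i =>
    HasJet.clm ((ContinuousLinearMap.proj i.succ).comp N) p u v
  refine (HasJet.sum Finset.univ fun i => (hc L i).mul (hc M i)).cast rfl rfl rfl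
    (Finset.sum_congr rfl fun i _ => by ring)

variable (p u v : Tangent n)

theorem jet_base_sq : HasJet (fun q : Tangent n => sdot q.1 q.1) p u v (sdot p.1 p.1)
    (2 * sdot p.1 u.1) (2 * sdot p.1 v.1) (2 * sdot u.1 v.1) :=
  (HasJet.sdot (ContinuousLinearMap.fst ℝ _ _) (ContinuousLinearMap.fst ℝ _ _) p u v).cast rfl
    (by simp [sdot_comm u.1]; ring) (by simp [sdot_comm v.1]; ring) (by simp [sdot_comm v.1]; ring)

theorem jet_fiber_sq : HasJet (fun q : Tangent n => sdot q.2 q.2) p u v (sdot p.2 p.2)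
    (2 * sdot p.2 u.2) (2 * sdot p.2 v.2) (2 * sdot u.2 v.2) :=
  (HasJet.sdot (ContinuousLinearMap.snd ℝ _ _) (ContinuousLinearMap.snd ℝ _ _) p u v).cast rfl
    (by simp [sdot_comm u.2]; ring) (by simp [sdot_comm v.2]; ring) (by simp [sdot_comm v.2]; ring)

theorem jet_cross : HasJet (fun q : Tangent n => sdot q.1 q.2) p u v (sdot p.1 p.2)
    (sdot p.1 u.2 + sdot p.2 u.1) (sdot p.1 v.2 + sdot p.2 v.1)
    (sdot u.1 v.2 + sdot v.1 u.2) :=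
  (HasJet.sdot (ContinuousLinearMap.fst ℝ _ _) (ContinuousLinearMap.snd ℝ _ _) p u v).cast rfl
    (by simp [sdot_comm u.1]; ring) (by simp [sdot_comm v.1]; ring) (by simp)

theorem jet_base_coord (i : Fin (n + 1)) :
    HasJet (fun q : Tangent n => q.1 i) p u v (p.1 i) (u.1 i) (v.1 i) 0 :=
  HasJet.clm ((ContinuousLinearMap.proj i).comp (ContinuousLinearMap.fst ℝ _ _)) p u v

theorem jet_fiber_coord (i : Fin (n + 1)) :
    HasJet (fun q : Tangent n => q.2 i) p u v (p.2 i) (u.2 i) (v.2 i) 0 :=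
  HasJet.clm ((ContinuousLinearMap.proj i).comp (ContinuousLinearMap.snd ℝ _ _)) p u v

/-- The square of the Riemannian norm `α² = a(|x̄|²)² (y⁰)² + b(|x̄|²) |ȳ|²`. -/
def riemSq (a b : ℝ → ℝ) (x y : Fin (n + 1) → ℝ) : ℝ :=
  a (sdot x x) ^ 2 * y 0 ^ 2 + b (sdot x x) * sdot y y

/-- The Randers metric `F = α + ε a y⁰` with `α² = a² (y⁰)² + b |ȳ|²`, where the coefficients `a`
and `b` are functions of `|x̄|²`, which is smooth where `|x̄|` need not be. -/
noncomputable def randers (ε : ℝ) (a b : ℝ → ℝ) (x y : Fin (n + 1) → ℝ) : ℝ :=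
  √(riemSq a b x y) + ε * a (sdot x x) * y 0

variable {p u v} {a b : ℝ → ℝ} {ε : ℝ}

theorem riemSq_pos {x y : Fin (n + 1) → ℝ} (ha : 0 < a (sdot x x)) (hb : 0 < b (sdot x x))
    (hy : y ≠ 0) : 0 < riemSq a b x y := by
  have h1 := sdot_self_nonneg y
  have h2 : 0 ≤ a (sdot x x) ^ 2 * y 0 ^ 2 := by positivity
  have h3 : 0 ≤ b (sdot x x) * sdot y y := by positivity
  refine lt_of_le_of_ne (add_nonneg h2 h3) fun h => hy ?_
  have h4 : a (sdot x x) ^ 2 * y 0 ^ 2 = 0 := by unfold riemSq at h; linarith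
  have h5 : b (sdot x x) * sdot y y = 0 := by unfold riemSq at h; linarith
  have h6 : y 0 = 0 := by simpa [ha.ne'] using h4
  have h7 : sdot y y = 0 := by simpa [hb.ne'] using h5
  ext i
  refine Fin.cases h6 (fun j => sdot_self_eq_zero h7 j) i

theorem randers_pos (hε : |ε| < 1) {x y : Fin (n + 1) → ℝ} (ha : 0 < a (sdot x x))
    (hb : 0 < b (sdot x x)) (hy : y ≠ 0) : 0 < randers ε a b x y := by
  have hQ := riemSq_pos (a := a) (b := b) ha hb hy
  have h1 : |a (sdot x x) * y 0| ≤ √(riemSq a b x y) := by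
    refine Real.abs_le_sqrt ?_
    have := mul_nonneg hb.le (sdot_self_nonneg y)
    unfold riemSq; nlinarith
  have h2 : |ε * (a (sdot x x) * y 0)| < √(riemSq a b x y) := by
    rw [abs_mul]
    have := Real.sqrt_pos.mpr hQ
    nlinarith [abs_nonneg ε]
  have h3 := (abs_lt.mp h2).1
  unfold randers
  linarith

/-- The jet of `α²` along directions `u`, `v`, the first of which is vertical. -/
theorem jet_riemSq (ha : ContDiffAt ℝ 2 a (sdot p.1 p.1)) (hb : ContDiffAt ℝ 2 b (sdot p.1 p.1))
    (hu : u.1 = 0) : HasJet (onPairs (riemSq a b)) p u v (riemSq a b p.1 p.2)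
      (2 * (a (sdot p.1 p.1) ^ 2 * p.2 0 * u.2 0 + b (sdot p.1 p.1) * sdot p.2 u.2))
      (2 * (a (sdot p.1 p.1) ^ 2 * p.2 0 * v.2 0 + b (sdot p.1 p.1) * sdot p.2 v.2)
        + 2 * sdot p.1 v.1 * (2 * a (sdot p.1 p.1) * deriv a (sdot p.1 p.1) * p.2 0 ^ 2
          + deriv b (sdot p.1 p.1) * sdot p.2 p.2))
      (2 * (a (sdot p.1 p.1) ^ 2 * u.2 0 * v.2 0 + b (sdot p.1 p.1) * sdot u.2 v.2)
        + 4 * sdot p.1 v.1 * (2 * a (sdot p.1 p.1) * deriv a (sdot p.1 p.1) * p.2 0 * u.2 0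
          + deriv b (sdot p.1 p.1) * sdot p.2 u.2)) := by
  have js := jet_base_sq p u v
  have jy := jet_fiber_coord p u v 0
  have ja := js.comp ha
  have jb := js.comp hb
  have jay := ja.mul jy
  refine (((jay.mul jay).add (jb.mul (jet_fiber_sq p u v))).cast ?_ ?_ ?_ ?_).congr
    (Filter.Eventually.of_forall fun q => ?_)
  · unfold riemSq; ring
  · simp only [hu, sdot_zero_right]; ring
  · ring
  · simp only [hu, sdot_zero_right, sdot_zero_left]; ring
  · simp only [onPairs, riemSq]; ring

/-- The derivative of `α²` in a horizontal direction; the second derivative is not needed. -/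
theorem jet_riemSq_base (ha : ContDiffAt ℝ 2 a (sdot p.1 p.1))
    (hb : ContDiffAt ℝ 2 b (sdot p.1 p.1)) (hu : u.2 = 0) :
    ∃ k, HasJet (onPairs (riemSq a b)) p u u (riemSq a b p.1 p.2)
      (2 * sdot p.1 u.1 * (2 * a (sdot p.1 p.1) * deriv a (sdot p.1 p.1) * p.2 0 ^ 2
          + deriv b (sdot p.1 p.1) * sdot p.2 p.2))
      (2 * sdot p.1 u.1 * (2 * a (sdot p.1 p.1) * deriv a (sdot p.1 p.1) * p.2 0 ^ 2
          + deriv b (sdot p.1 p.1) * sdot p.2 p.2)) k := by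
  have js := jet_base_sq p u u
  have jy := jet_fiber_coord p u u 0
  have ja := js.comp ha
  have jb := js.comp hb
  have jay := ja.mul jy
  refine ⟨_, (((jay.mul jay).add (jb.mul (jet_fiber_sq p u u))).cast ?_ ?_ ?_ rfl).congr
    (Filter.Eventually.of_forall fun q => ?_)⟩
  · unfold riemSq; ring
  · simp only [hu, sdot_zero_right, Pi.zero_apply]; ring
  · simp only [hu, sdot_zero_right, Pi.zero_apply]; ring
  · simp only [onPairs, riemSq]; ring

/-- The jet of the one-form `ε a y⁰` along directions `u`, `v`, the first of which is vertical. -/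
theorem jet_linear_term (ha : ContDiffAt ℝ 2 a (sdot p.1 p.1)) (hu : u.1 = 0) :
    HasJet (fun q : Tangent n => ε * a (sdot q.1 q.1) * q.2 0) p u v (ε * a (sdot p.1 p.1) * p.2 0)
      (ε * a (sdot p.1 p.1) * u.2 0)
      (ε * (a (sdot p.1 p.1) * v.2 0 + 2 * deriv a (sdot p.1 p.1) * sdot p.1 v.1 * p.2 0))
      (ε * (2 * deriv a (sdot p.1 p.1) * sdot p.1 v.1 * u.2 0)) :=
  ((((jet_base_sq p u v).comp ha).const_mul ε).mul (jet_fiber_coord p u v 0)).cast rfl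
    (by simp [hu]) (by ring) (by simp [hu]; ring)

/-- The jet of `F` along directions `u`, `v`, the first of which is vertical, in terms of the jet
of `α²`. -/
theorem jet_randers {Qu Qv Quv r : ℝ} (ha : ContDiffAt ℝ 2 a (sdot p.1 p.1)) (hu : u.1 = 0)
    (hr : 0 < r) (hr2 : r ^ 2 = riemSq a b p.1 p.2)
    (hQ : HasJet (onPairs (riemSq a b)) p u v (riemSq a b p.1 p.2) Qu Qv Quv) :
    HasJet (onPairs (randers ε a b)) p u v (r + ε * a (sdot p.1 p.1) * p.2 0)
      (Qu / (2 * r) + ε * a (sdot p.1 p.1) * u.2 0)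
      (Qv / (2 * r) + ε * (a (sdot p.1 p.1) * v.2 0
        + 2 * deriv a (sdot p.1 p.1) * sdot p.1 v.1 * p.2 0))
      (Quv / (2 * r) - Qu * Qv / (4 * r ^ 3)
        + ε * (2 * deriv a (sdot p.1 p.1) * sdot p.1 v.1 * u.2 0)) :=
  (hQ.sqrt hr hr2).add (jet_linear_term ha hu)

theorem jet_sqr {F : (Fin (n + 1) → ℝ) → (Fin (n + 1) → ℝ) → ℝ} {h hu hv huv : ℝ}
    (J : HasJet (onPairs F) p u v h hu hv huv) :
    HasJet (onPairs (sqr F)) p u v (h ^ 2) (2 * h * hu) (2 * h * hv)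
      (2 * (hu * hv + h * huv)) :=
  ((J.mul J).cast (by ring) (by ring) (by ring) (by ring)).congr
    (Filter.Eventually.of_forall fun q => by simp only [onPairs, sqr]; ring)

/-- The inner product on the tangent space whose quadratic form is `α²`. -/
def riemInner (a b : ℝ) (u v : Fin (n + 1) → ℝ) : ℝ := a ^ 2 * u 0 * v 0 + b * sdot u v

/-- The Hessian of `F²` in the vertical directions `u`, `v` is
`2 (F_u F_v + F (⟨u, v⟩ / α - ⟨y, u⟩ ⟨y, v⟩ / α³))`. -/
theorem secondDeriv_sqr_randers {x y : Fin (n + 1) → ℝ} (ha : ContDiffAt ℝ 2 a (sdot x x))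
    (hb : ContDiffAt ℝ 2 b (sdot x x)) {r : ℝ} (hr : 0 < r) (hr2 : r ^ 2 = riemSq a b x y)
    (c d : Fin (n + 1) → ℝ) :
    secondDeriv (onPairs (sqr (randers ε a b))) (x, y) (0, c) (0, d) =
      2 * ((riemInner (a (sdot x x)) (b (sdot x x)) y c / r + ε * a (sdot x x) * c 0)
          * (riemInner (a (sdot x x)) (b (sdot x x)) y d / r + ε * a (sdot x x) * d 0)
        + (r + ε * a (sdot x x) * y 0) * (riemInner (a (sdot x x)) (b (sdot x x)) c d / r
          - riemInner (a (sdot x x)) (b (sdot x x)) y c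
            * riemInner (a (sdot x x)) (b (sdot x x)) y d / r ^ 3)) := by
  have J := jet_sqr (jet_randers (ε := ε) (p := (x, y)) (u := (0, c)) (v := (0, d)) ha rfl hr hr2
    (jet_riemSq ha hb rfl))
  refine J.duv.trans ?_
  simp only [sdot_zero_right, riemInner]
  field_simp
  ring

/-- A Randers metric whose one-form is shorter than `1` is strongly convex. -/
theorem fundamentalTensor_randers_posDef (hε : |ε| < 1) {x y : Fin (n + 1) → ℝ}
    (hac : ContDiffAt ℝ 2 a (sdot x x)) (hbc : ContDiffAt ℝ 2 b (sdot x x))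
    (ha : 0 < a (sdot x x)) (hb : 0 < b (sdot x x)) (hy : y ≠ 0) :
    (fundamentalTensor (randers ε a b) x y).PosDef := by
  have hQ := riemSq_pos (a := a) (b := b) ha hb hy
  set r := √(riemSq a b x y) with hr_def
  have hr : 0 < r := Real.sqrt_pos.mpr hQ
  have hr2 : r ^ 2 = riemSq a b x y := Real.sq_sqrt hQ.le
  have hF : 0 < r + ε * a (sdot x x) * y 0 := randers_pos hε ha hb hy
  have hC : ContDiffAt ℝ 2 (onPairs (sqr (randers ε a b))) (x, y) :=
    (jet_sqr (jet_randers (ε := ε) (p := (x, y)) (u := 0) (v := 0) hac rfl hr hr2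
      (jet_riemSq hac hbc rfl))).smooth
  have hH := secondDeriv_sqr_randers (ε := ε) hac hbc hr hr2
  have entry : ∀ A B, fundamentalTensor (randers ε a b) x y A B
      = (1 / 2) * secondDeriv (onPairs (sqr (randers ε a b))) (x, y) (0, Pi.single A 1)
        (0, Pi.single B 1) := fun A B => by
    simp [fundamentalTensor, pdy_pdy_eq hC]
  set a' := a (sdot x x)
  set b' := b (sdot x x)
  have hquad : ∀ v, dotProduct v ((fundamentalTensor (randers ε a b) x y).mulVec v)
      = (1 / 2) * secondDeriv (onPairs (sqr (randers ε a b))) (x, y) (0, v) (0, v) := by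
    intro v
    rw [secondDeriv_eq hC]
    set T := fderiv ℝ (fderiv ℝ (onPairs (sqr (randers ε a b)))) (x, y)
    rw [← sum_linear_single_snd (T (0, v)) v, Finset.mul_sum]
    refine Finset.sum_congr rfl fun A _ => ?_
    have h := sum_linear_single_snd (T.flip (0, Pi.single A 1)) v
    simp only [ContinuousLinearMap.flip_apply] at h
    rw [← h, Matrix.mulVec, dotProduct, Finset.mul_sum, Finset.sum_mul, Finset.mul_sum]
    refine Finset.sum_congr rfl fun B _ => ?_
    rw [entry, secondDeriv_eq hC]
    ring
  refine Matrix.PosDef.of_dotProduct_mulVec_pos ?_ fun v hv => ?_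
  · ext A B
    simp only [Matrix.conjTranspose_apply, star_trivial, entry, hH, riemInner,
      sdot_comm (Pi.single A 1)]
    ring
  · simp only [star_trivial]
    rw [hquad, hH]
    have hQ' : a' ^ 2 * y 0 ^ 2 + b' * sdot y y = r ^ 2 := hr2.symm
    -- The form vanishes only if `v` is a multiple of `y`, by the equality case of Cauchy–Schwarz,
    -- which is read off from the vector `z = α² v - ⟨y, v⟩ y`.
    set m := riemInner a' b' y v with hm
    set z := r ^ 2 • v - m • y with hz
    have hzz : riemInner a' b' z z = r ^ 2 * (r ^ 2 * riemInner a' b' v v - m ^ 2) := by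
      have e1 : sdot z z = r ^ 4 * sdot v v - 2 * r ^ 2 * m * sdot y v + m ^ 2 * sdot y y := by
        rw [hz, sub_eq_add_neg, ← neg_smul, sdot_add_left, sdot_smul_left, sdot_smul_left,
          sdot_comm v, sdot_comm y, sdot_add_left, sdot_add_left, sdot_smul_left, sdot_smul_left,
          sdot_smul_left, sdot_smul_left, sdot_comm v y]
        ring
      have e2 : z 0 = r ^ 2 * v 0 - m * y 0 := by simp [hz]
      have e3 : b' * sdot y y = r ^ 2 - a' ^ 2 * y 0 ^ 2 := by linarith
      have e4 : b' * sdot y v = m - a' ^ 2 * y 0 * v 0 := by rw [hm, riemInner]; ring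
      simp only [riemInner]
      rw [e1, e2]
      linear_combination (-2 * r ^ 2 * m) * e4 + m ^ 2 * e3
    have hrS : riemSq (fun _ => a') (fun _ => b') x z = riemInner a' b' z z := by
      simp only [riemSq, riemInner]; ring
    have hsq := sq_nonneg (m / r + ε * a' * v 0)
    have e5 : riemInner a' b' v v / r - m * m / r ^ 3 = riemInner a' b' z z / r ^ 5 := by
      rw [hzz]; field_simp
    rw [e5]
    by_cases hz0 : z = 0
    · have hm0 : m ≠ 0 := by
        intro h
        rw [hz, h, zero_smul, sub_zero] at hz0
        exact hv ((smul_eq_zero.mp hz0).resolve_left (by positivity))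
      have e6 : r ^ 2 * v 0 = m * y 0 := by
        have := congrFun hz0 0
        simp only [hz, Pi.sub_apply, Pi.smul_apply, smul_eq_mul, Pi.zero_apply] at this
        linarith
      have e7 : m / r + ε * a' * v 0 = m * (r + ε * a' * y 0) / r ^ 2 := by
        field_simp
        linear_combination ε * a' * e6
      have e8 : m / r + ε * a' * v 0 ≠ 0 := by
        rw [e7]; exact div_ne_zero (mul_ne_zero hm0 hF.ne') (by positivity)
      have e9 : riemInner a' b' z z = 0 := by rw [hz0]; simp [riemInner]
      rw [e9, zero_div, mul_zero, add_zero]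
      have := mul_self_pos.mpr e8
      linarith
    · have h1 := riemSq_pos (x := x) (a := fun _ => a') (b := fun _ => b') ha hb hz0
      rw [hrS] at h1
      have h2 : 0 < (r + ε * a' * y 0) * (riemInner a' b' z z / r ^ 5) := by positivity
      nlinarith

end Metric

/-! ### The spray of the Randers ansatz -/

section Spray

variable {n : ℕ} {a b : ℝ → ℝ} {ε : ℝ}

/-- The factor `P` of the projective part `P y` of the spray, which comes from the one-form
`ε a dx⁰`. Division by `F` is harmless at `y ≠ 0`. -/
noncomputable def sprayP (ε : ℝ) (a b : ℝ → ℝ) (x y : Fin (n + 1) → ℝ) : ℝ :=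
  -(ε * (1 - ε ^ 2) * deriv a (sdot x x) * sdot x y * y 0) / randers ε a b x y
    - ε ^ 2 * deriv a (sdot x x) * sdot x y / a (sdot x x)

/-- The coefficient `V` of the central part `-V x̄` of the spray. -/
noncomputable def sprayV (ε : ℝ) (a b : ℝ → ℝ) (x y : Fin (n + 1) → ℝ) : ℝ :=
  (deriv b (sdot x x) * sdot y y / 2 + a (sdot x x) * deriv a (sdot x x) * y 0 ^ 2
    + ε * deriv a (sdot x x) * √(riemSq a b x y) * y 0) / b (sdot x x)

/-- The component `G⁰` of the spray. -/
noncomputable def sprayTime (ε : ℝ) (a b : ℝ → ℝ) (x y : Fin (n + 1) → ℝ) : ℝ :=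
  y 0 * (2 * deriv a (sdot x x) * sdot x y / a (sdot x x) + sprayP ε a b x y)
    + ε * √(riemSq a b x y) * deriv a (sdot x x) * sdot x y / a (sdot x x) ^ 2

/-- The component `Gʲ` of the spray. -/
noncomputable def spraySpace (ε : ℝ) (a b : ℝ → ℝ) (j : Fin n) (x y : Fin (n + 1) → ℝ) : ℝ :=
  (deriv b (sdot x x) * sdot x y / b (sdot x x) + sprayP ε a b x y) * y j.succ
    - sprayV ε a b x y * x j.succ

theorem sdot_cons_space (c : ℝ) (k m : ℝ) (x y z : Fin (n + 1) → ℝ) :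
    sdot z (Fin.cons c fun j : Fin n => k * y j.succ - m * x j.succ)
      = k * sdot z y - m * sdot z x := by
  simp only [sdot, Fin.cons_succ, Finset.mul_sum, ← Finset.sum_sub_distrib]
  exact Finset.sum_congr rfl fun i _ => by ring

/-- The algebraic identity behind the Euler–Lagrange equation of `F²`: here `Q1`, `Q2`, `Q12` are
the derivatives of `α²`, `G0`, `yG`, `cG` are `G⁰`, `⟨ȳ, Ḡ⟩`, `⟨c̄, Ḡ⟩`, and `t`, `w`, `yc`, `xc`
are `⟨x̄, ȳ⟩`, `|ȳ|²`, `⟨ȳ, c̄⟩`, `⟨x̄, c̄⟩`. -/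
theorem eulerLagrange_identity {A B A' B' e r y0 c0 t w yc xc G0 yG cG P V Q1 Q2 Q12 F : ℝ}
    (hA : A ≠ 0) (hB : B ≠ 0) (hr : r ≠ 0) (hF : F ≠ 0) (eF : F = r + e * A * y0)
    (hw : r ^ 2 = A ^ 2 * y0 ^ 2 + B * w)
    (hP : P = -(e * (1 - e ^ 2) * A' * t * y0) / F - e ^ 2 * A' * t / A)
    (hV : V = (B' * w / 2 + A * A' * y0 ^ 2 + e * A' * r * y0) / B)
    (hG0 : G0 = y0 * (2 * A' * t / A + P) + e * r * A' * t / A ^ 2)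
    (hyG : yG = (B' * t / B + P) * w - V * t) (hcG : cG = (B' * t / B + P) * yc - V * xc)
    (hQ1 : Q1 = 2 * (A ^ 2 * y0 * c0 + B * yc))
    (hQ2 : Q2 = 2 * (A ^ 2 * y0 * (2 * G0) + B * (2 * yG))
      + 2 * -t * (2 * A * A' * y0 ^ 2 + B' * w))
    (hQ12 : Q12 = 2 * (A ^ 2 * c0 * (2 * G0) + B * (2 * cG))
      + 4 * -t * (2 * A * A' * y0 * c0 + B' * yc)) :
    2 * ((Q1 / (2 * r) + e * A * c0) * (Q2 / (2 * r) + e * (A * (2 * G0) + 2 * A' * -t * y0))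
      + F * (Q12 / (2 * r) - Q1 * Q2 / (4 * r ^ 3) + e * (2 * A' * -t * c0)))
    + 2 * F * (2 * xc * (2 * A * A' * y0 ^ 2 + B' * w) / (2 * r) + e * (2 * A' * xc * y0)) = 0 := by
  have hw' : w = (r ^ 2 - A ^ 2 * y0 ^ 2) / B := by field_simp; linarith
  have hP' : P * F = -(e * (1 - e ^ 2) * A' * t * y0) - e ^ 2 * A' * t / A * F := by
    rw [hP]; field_simp
  -- The derivative of `F` along the geodesic flow vanishes.
  have hq : Q2 / (2 * r) + e * (A * (2 * G0) + 2 * A' * -t * y0) = 0 := by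
    have : Q2 / (2 * r) + e * (A * (2 * G0) + 2 * A' * -t * y0)
        = 2 * (P * F - (-(e * (1 - e ^ 2) * A' * t * y0) - e ^ 2 * A' * t / A * F)) := by
      subst hQ2 hyG hG0 hV hw' eF
      field_simp
      ring
    rw [this, hP', sub_self, mul_zero]
  have hQ2' : Q2 = -(2 * r * (e * (A * (2 * G0) + 2 * A' * -t * y0))) := by
    field_simp at hq; linarith
  -- What remains is `F` times the Euler–Lagrange expression of `F` itself.
  have hS : Q12 / (2 * r) - Q1 * Q2 / (4 * r ^ 3) + e * (2 * A' * -t * c0)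
      + (2 * xc * (2 * A * A' * y0 ^ 2 + B' * w) / (2 * r) + e * (2 * A' * xc * y0))
      = Q1 / r ^ 2 * (P * F - (-(e * (1 - e ^ 2) * A' * t * y0) - e ^ 2 * A' * t / A * F)) := by
    rw [hQ2']
    clear hq hQ2 hQ2' hP' hP hyG
    subst hQ12 hQ1 hcG hG0 hV hw' eF
    field_simp
    ring
  rw [hP', sub_self, mul_zero] at hS
  rw [hq]
  linear_combination 2 * F * hS

/-- `F` is the Randers metric with coefficients `a`, `b` over the points with `|x̄|² ∈ J`, and its
fundamental tensor is positive definite there. -/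
structure IsRadialRanders (J : Set ℝ) (ε : ℝ) (a b : ℝ → ℝ)
    (F : (Fin (n + 1) → ℝ) → (Fin (n + 1) → ℝ) → ℝ) : Prop where
  isOpen : IsOpen J
  smooth_a : ContDiffOn ℝ ∞ a J
  smooth_b : ContDiffOn ℝ ∞ b J
  pos_a : ∀ s ∈ J, 0 < a s
  pos_b : ∀ s ∈ J, 0 < b s
  abs_lt : |ε| < 1
  eq_randers : ∀ x, sdot x x ∈ J → ∀ y, F x y = randers ε a b x y
  convex : ∀ x, sdot x x ∈ J → ∀ y, y ≠ 0 → (fundamentalTensor F x y).PosDef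

theorem continuous_sdot_self : Continuous fun x : Fin (n + 1) → ℝ => sdot x x := by
  unfold sdot; fun_prop

theorem contDiffAt_deriv_of_contDiffOn {J : Set ℝ} {φ : ℝ → ℝ} (hJ : IsOpen J)
    (h : ContDiffOn ℝ ∞ φ J) {s : ℝ} (hs : s ∈ J) :
    ContDiffAt ℝ 2 φ s ∧ ContDiffAt ℝ 2 (deriv φ) s := by
  have h1 : ContDiffAt ℝ ∞ φ s := h.contDiffAt (hJ.mem_nhds hs)
  have h2 : ContDiffOn ℝ ∞ (deriv φ) J := ((contDiffOn_infty_iff_deriv_of_isOpen hJ).mp h).2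
  have h3 : ContDiffAt ℝ ∞ (deriv φ) s := h2.contDiffAt (hJ.mem_nhds hs)
  have e : (2 : WithTop ℕ∞) ≤ ∞ := WithTop.coe_le_coe.mpr le_top
  exact ⟨h1.of_le e, h3.of_le e⟩

namespace IsRadialRanders

variable {J : Set ℝ} {F : (Fin (n + 1) → ℝ) → (Fin (n + 1) → ℝ) → ℝ} {x y : Fin (n + 1) → ℝ}

theorem eventually_mem (H : IsRadialRanders J ε a b F) (hx : sdot x x ∈ J) (hy : y ≠ 0) :
    ∀ᶠ q : Tangent n in nhds (x, y), sdot q.1 q.1 ∈ J ∧ q.2 ≠ 0 :=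
  Filter.Eventually.and
    ((H.isOpen.preimage (continuous_sdot_self.comp continuous_fst)).mem_nhds hx)
    (continuous_snd.continuousAt.eventually_ne hy)

theorem spray_eq (H : IsRadialRanders J ε a b F) (hx : sdot x x ∈ J) (hy : y ≠ 0)
    (C : Fin (n + 1)) : spray F C x y
      = (Fin.cons (sprayTime ε a b x y) fun j => spraySpace ε a b j x y : Fin (n + 1) → ℝ) C := by
  have ha := H.pos_a _ hx
  have hb := H.pos_b _ hx
  have hac := (contDiffAt_deriv_of_contDiffOn H.isOpen H.smooth_a hx).1
  have hbc := (contDiffAt_deriv_of_contDiffOn H.isOpen H.smooth_b hx).1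
  have hQ := riemSq_pos (a := a) (b := b) ha hb hy
  set r := √(riemSq a b x y) with hr_def
  have hr : 0 < r := Real.sqrt_pos.mpr hQ
  have hr2 : r ^ 2 = riemSq a b x y := Real.sq_sqrt hQ.le
  have e : onPairs F =ᶠ[nhds (x, y)] onPairs (randers ε a b) := by
    filter_upwards [H.eventually_mem hx hy] with q hq
    exact H.eq_randers q.1 hq.1 q.2
  refine spray_eq_of_eulerLagrange ?_ (H.convex x hx y hy) _ (fun A => ?_) C
  · exact (jet_sqr ((jet_randers (ε := ε) (p := (x, y)) (u := 0) (v := 0) hac rfl hr hr2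
      (jet_riemSq hac hbc rfl)).congr e)).smooth
  set c : Fin (n + 1) → ℝ := Pi.single A 1
  set G : Fin (n + 1) → ℝ := Fin.cons (sprayTime ε a b x y) fun j => spraySpace ε a b j x y
  have j1 := jet_sqr ((jet_randers (ε := ε) (p := (x, y)) (u := (0, c)) (v := (-y, (2 : ℝ) • G))
    hac rfl hr hr2 (jet_riemSq hac hbc rfl)).congr e)
  obtain ⟨k, j0⟩ := jet_riemSq_base (a := a) (b := b) (p := (x, y)) (u := (c, 0)) hac hbc rfl
  have j2 := (((j0.sqrt hr hr2).add ((((jet_base_sq (x, y) (c, 0) (c, 0)).comp hac).const_mul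
    ε).mul (jet_fiber_coord (x, y) (c, 0) (c, 0) 0))).congr
      (K := onPairs F) e)
  -- The Euler–Lagrange equation is one mixed second derivative plus one horizontal derivative
  -- of `F²`.
  have hd1 := j1.duv
  have hd2 := (jet_sqr j2).du
  unfold secondDeriv
  rw [hd1, hd2]
  have hG : ∀ z, sdot z G = (deriv b (sdot x x) * sdot x y / b (sdot x x) + sprayP ε a b x y)
      * sdot z y - sprayV ε a b x y * sdot z x := fun z => sdot_cons_space _ _ _ x y z
  have hFpos := randers_pos (ε := ε) (a := a) (b := b) H.abs_lt ha hb hy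
  have key := eulerLagrange_identity (c0 := c 0) (yc := sdot y c) (xc := sdot x c)
    (G0 := sprayTime ε a b x y)
    (yG := sdot y G) (cG := sdot c G) (e := ε) (t := sdot x y) ha.ne' hb.ne' hr.ne' hFpos.ne'
    rfl hr2 (P := sprayP ε a b x y) rfl (V := sprayV ε a b x y) rfl rfl
    (by rw [hG, sdot_comm y x]) (by rw [hG, sdot_comm c y, sdot_comm c x]) rfl rfl rfl
  refine Eq.trans ?_ key
  simp only [Pi.smul_apply, smul_eq_mul, sdot_smul_right, sdot_neg_right, Pi.zero_apply]
  have : G 0 = sprayTime ε a b x y := rfl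
  rw [this]
  simp only [randers, ← hr_def]
  ring

theorem spray_time_eventuallyEq (H : IsRadialRanders J ε a b F) (hx : sdot x x ∈ J) (hy : y ≠ 0) :
    onPairs (spray F 0) =ᶠ[nhds (x, y)] onPairs (sprayTime ε a b) := by
  filter_upwards [H.eventually_mem hx hy] with q hq
  exact H.spray_eq hq.1 hq.2 0

theorem spray_space_eventuallyEq (H : IsRadialRanders J ε a b F) (hx : sdot x x ∈ J) (hy : y ≠ 0)
    (j : Fin n) : onPairs (spray F j.succ) =ᶠ[nhds (x, y)] onPairs (spraySpace ε a b j) := by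
  filter_upwards [H.eventually_mem hx hy] with q hq
  exact H.spray_eq hq.1 hq.2 j.succ

end IsRadialRanders

end Spray

/-! ### The Ricci curvature when `a` is constant -/

section Flat

variable {n : ℕ} {a b : ℝ → ℝ} {ε : ℝ}

/-- The spray component `Γ(|x̄|²) (⟨x̄, ȳ⟩ yʲ - |ȳ|² xʲ / 2)` of the conformally flat metric
`b |ȳ|²`, where `Γ = b' / b`. -/
noncomputable def conformalSpray (Γ : ℝ → ℝ) (j : Fin n) (x y : Fin (n + 1) → ℝ) : ℝ :=
  Γ (sdot x x) * (sdot x y * y j.succ - (1 / 2) * (sdot y y * x j.succ))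

theorem jet_conformalSpray {Γ : ℝ → ℝ} {p u v : Tangent n}
    (hΓ : ContDiffAt ℝ 2 Γ (sdot p.1 p.1)) (hv : v.1 = 0) (j : Fin n) :
    HasJet (onPairs (conformalSpray Γ j)) p u v (conformalSpray Γ j p.1 p.2)
      (Γ (sdot p.1 p.1) * ((sdot p.1 u.2 + sdot p.2 u.1) * p.2 j.succ + sdot p.1 p.2 * u.2 j.succ
          - sdot p.2 u.2 * p.1 j.succ - sdot p.2 p.2 * u.1 j.succ / 2)
        + 2 * deriv Γ (sdot p.1 p.1) * sdot p.1 u.1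
          * (sdot p.1 p.2 * p.2 j.succ - sdot p.2 p.2 * p.1 j.succ / 2))
      (Γ (sdot p.1 p.1) * (sdot p.1 v.2 * p.2 j.succ + sdot p.1 p.2 * v.2 j.succ
          - sdot p.2 v.2 * p.1 j.succ))
      (Γ (sdot p.1 p.1) * (sdot u.1 v.2 * p.2 j.succ
          + (sdot p.1 u.2 + sdot p.2 u.1) * v.2 j.succ + sdot p.1 v.2 * u.2 j.succ
          - sdot u.2 v.2 * p.1 j.succ - sdot p.2 v.2 * u.1 j.succ)
        + 2 * deriv Γ (sdot p.1 p.1) * sdot p.1 u.1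
          * (sdot p.1 v.2 * p.2 j.succ + sdot p.1 p.2 * v.2 j.succ
            - sdot p.2 v.2 * p.1 j.succ)) := by
  refine (((jet_base_sq p u v).comp hΓ).mul
    (((jet_cross p u v).mul (jet_fiber_coord p u v j.succ)).sub
      (((jet_fiber_sq p u v).mul (jet_base_coord p u v j.succ)).const_mul (1 / 2)))).cast rfl
    (by ring) ?_ ?_
  all_goals
    simp only [hv, sdot_zero_left, sdot_zero_right, Pi.zero_apply]
    ring

variable {J : Set ℝ} {F : (Fin (n + 1) → ℝ) → (Fin (n + 1) → ℝ) → ℝ} {x y : Fin (n + 1) → ℝ}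

/-- If `a` is constant, the spray is that of the conformally flat metric `b |ȳ|²`. -/
theorem IsRadialRanders.spray_eventuallyEq_of_deriv_eq_zero (H : IsRadialRanders J ε a b F)
    (h0 : ∀ s ∈ J, deriv a s = 0) (hx : sdot x x ∈ J) (hy : y ≠ 0) :
    onPairs (spray F 0) =ᶠ[nhds (x, y)] (fun _ => 0) ∧ ∀ j : Fin n,
      onPairs (spray F j.succ) =ᶠ[nhds (x, y)]
        onPairs (conformalSpray (fun s => deriv b s / b s) j) := by
  refine ⟨?_, fun j => ?_⟩
  · filter_upwards [H.eventually_mem hx hy, H.spray_time_eventuallyEq hx hy] with q hq e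
    rw [e]
    simp [onPairs, sprayTime, sprayP, h0 _ hq.1]
  · filter_upwards [H.eventually_mem hx hy, H.spray_space_eventuallyEq hx hy j] with q hq e
    rw [e]
    simp only [onPairs, spraySpace, sprayP, sprayV, conformalSpray, h0 _ hq.1]
    simp only [mul_zero, zero_mul, neg_zero, zero_div, sub_zero, add_zero]
    ring

/-- The trace of the square of the matrix `∂Gʲ/∂yⁱ` for the spray of a conformally flat metric. -/
theorem sum_bivector_sq (x y : Fin (n + 1) → ℝ) (k t : ℝ) :
    ∑ j : Fin n, ∑ i : Fin n,
      k * (x i.succ * y j.succ + t * (Pi.single i.succ 1 : Fin (n + 1) → ℝ) j.succ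
          - y i.succ * x j.succ)
        * (k * (x j.succ * y i.succ + t * (Pi.single j.succ 1 : Fin (n + 1) → ℝ) i.succ
          - y j.succ * x i.succ))
      = k ^ 2 * (2 * sdot x y ^ 2 - 2 * sdot x x * sdot y y + n * t ^ 2) := by
  have e : ∀ j i : Fin n,
      k * (x i.succ * y j.succ + t * (Pi.single i.succ 1 : Fin (n + 1) → ℝ) j.succ
          - y i.succ * x j.succ)
        * (k * (x j.succ * y i.succ + t * (Pi.single j.succ 1 : Fin (n + 1) → ℝ) i.succ
          - y j.succ * x i.succ))
      = k ^ 2 * (2 * ((x j.succ * y j.succ) * (x i.succ * y i.succ))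
          - (y j.succ * y j.succ) * (x i.succ * x i.succ)
          - (x j.succ * x j.succ) * (y i.succ * y i.succ) + if i = j then t ^ 2 else 0) := by
    intro j i
    rcases eq_or_ne i j with rfl | h
    · simp; ring
    · simp [h, h.symm]; ring
  simp only [e, ← Finset.mul_sum, Finset.sum_add_distrib, Finset.sum_sub_distrib,
    ← Finset.sum_mul, Finset.sum_ite_eq', Finset.mem_univ, if_true, Finset.sum_const,
    Finset.card_univ, Fintype.card_fin, nsmul_eq_mul]
  simp only [sdot]
  ring

/-- The Ricci curvature of the conformally flat metric `b |ȳ|²`, in terms of `Γ = b' / b` as a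
function of `|x̄|²`. -/
theorem IsRadialRanders.ricci_eq_of_deriv_eq_zero (H : IsRadialRanders J ε a b F)
    (h0 : ∀ s ∈ J, deriv a s = 0) (hx : sdot x x ∈ J) (hy : y ≠ 0) {k l : ℝ}
    (hk : deriv b (sdot x x) / b (sdot x x) = k)
    (hl : deriv (fun s => deriv b s / b s) (sdot x x) = l) :
    ricci F x y = -((n : ℝ) - 2) * (2 * l * sdot x y ^ 2) - 2 * l * sdot x x * sdot y y
      - (2 * n - 2) * k * sdot y y
      + ((n : ℝ) - 2) * k ^ 2 * (sdot x y ^ 2 - sdot x x * sdot y y) := by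
  obtain ⟨e0, e⟩ := H.spray_eventuallyEq_of_deriv_eq_zero h0 hx hy
  obtain ⟨hb, hb'⟩ := contDiffAt_deriv_of_contDiffOn H.isOpen H.smooth_b hx
  have hΓ : ContDiffAt ℝ 2 (fun s => deriv b s / b s) (sdot x x) :=
    hb'.div hb (H.pos_b _ hx).ne'
  have J0 := fun u v => (HasJet.const 0 (x, y) u v).congr e0
  have Js := fun (j : Fin n) u v hv =>
    (jet_conformalSpray (p := (x, y)) (u := u) (v := v) hΓ hv j).congr (e j)
  have hS : ∀ C, ContDiffAt ℝ 2 (onPairs (spray F C)) (x, y) := by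
    intro C
    refine Fin.cases (J0 0 0).smooth (fun j => (Js j 0 0 rfl).smooth) C
  set G : Fin (n + 1) → ℝ := Fin.cons 0 fun j => k * sdot x y * y j.succ
    - k * sdot y y / 2 * x j.succ with hG
  have hSG : ∀ C, spray F C x y = G C := by
    intro C
    refine Fin.cases (J0 0 0).val (fun j => (Js j 0 0 rfl).val.trans ?_) C
    simp only [conformalSpray, hG, Fin.cons_succ, hk]
    ring
  have hzG : ∀ z, sdot z G = k * sdot x y * sdot z y - k * sdot y y / 2 * sdot z x :=
    fun z => sdot_cons_space _ _ _ x y z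
  have d0 : ∀ u, fderiv ℝ (onPairs (spray F 0)) (x, y) u = 0 := fun u => (J0 u 0).du
  have dd0 : ∀ u v, secondDeriv (onPairs (spray F 0)) (x, y) u v = 0 := fun u v => (J0 u v).duv
  have K0 : flagCurvature F 0 0 x y = 0 := by
    rw [flagCurvature_eq hS hSG]
    simp only [d0, dd0]
    simp
  have Kj : ∀ j : Fin n, flagCurvature F j.succ j.succ x y =
      2 * (k * (y j.succ * y j.succ - sdot y y / 2)
        + 2 * l * (sdot x y * (x j.succ * y j.succ) - sdot y y / 2 * (x j.succ * x j.succ)))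
      + (k * (2 * (k * sdot x y ^ 2 - k * sdot y y / 2 * sdot x x) - sdot y y)
        - 2 * l * sdot x y ^ 2)
      - ∑ i : Fin n,
        k * (x i.succ * y j.succ + sdot x y * (Pi.single i.succ 1 : Fin (n + 1) → ℝ) j.succ
          - y i.succ * x j.succ)
        * (k * (x j.succ * y i.succ + sdot x y * (Pi.single j.succ 1 : Fin (n + 1) → ℝ) i.succ
          - y j.succ * x i.succ)) := by
    intro j
    rw [flagCurvature_eq hS hSG, Fin.sum_univ_succ, d0, mul_zero, zero_add]
    have e1 := (Js j (Pi.single j.succ 1, 0) 0 rfl).du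
    have e2 := (Js j (-y, (2 : ℝ) • G) (0, Pi.single j.succ 1) rfl).duv
    have e3 : ∀ i m : Fin n, _ := fun i m => (Js i 0 (0, Pi.single m.succ 1) rfl).dv
    simp only [sdot_zero_right, sdot_single_succ, Pi.zero_apply, Pi.single_eq_same, mul_one,
      hk, hl] at e1 e3
    simp only [sdot_neg_right, sdot_smul_right, sdot_single_succ, hzG,
      Pi.single_eq_same, mul_one, Pi.smul_apply, Pi.neg_apply, smul_eq_mul, hk, hl] at e2
    rw [e1]
    unfold secondDeriv
    rw [e2]
    simp only [e3]
    ring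
  unfold ricci
  rw [Fin.sum_univ_succ, K0, zero_add]
  simp only [Kj]
  rw [Finset.sum_sub_distrib, sum_bivector_sq]
  simp only [← Finset.mul_sum, Finset.sum_add_distrib, Finset.sum_sub_distrib, Finset.sum_const,
    Finset.card_univ, Fintype.card_fin, nsmul_eq_mul]
  simp only [sdot]
  ring

end Flat

/-! ### The Ricci curvature in the directions `± ∂/∂x⁰` -/

section Pole

variable {n : ℕ} {a b : ℝ → ℝ} {ε σ : ℝ} {x : Fin (n + 1) → ℝ}

variable {c d : ℝ} {u v : Fin (n + 1) → ℝ}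

theorem jet_pole_radial {φ : ℝ → ℝ} (hφ : ContDiffAt ℝ 2 φ (sdot x x)) :
    HasJet (fun q : Tangent n => φ (sdot q.1 q.1)) (x, Pi.single 0 σ) (Pi.single 0 c, u)
      (Pi.single 0 d, v) (φ (sdot x x)) 0 0 0 :=
  ((jet_base_sq (x, Pi.single 0 σ) (Pi.single 0 c, u) (Pi.single 0 d, v)).comp hφ).cast rfl
    (by simp) (by simp) (by simp)

theorem jet_pole_cross :
    HasJet (fun q : Tangent n => sdot q.1 q.2) (x, Pi.single 0 σ) (Pi.single 0 c, u)
      (Pi.single 0 d, v) 0 (sdot x u) (sdot x v) 0 :=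
  (jet_cross (x, Pi.single 0 σ) (Pi.single 0 c, u) (Pi.single 0 d, v)).cast
    (by simp) (by simp) (by simp) (by simp)

theorem jet_pole_fiber_sq :
    HasJet (fun q : Tangent n => sdot q.2 q.2) (x, Pi.single 0 σ) (Pi.single 0 c, u)
      (Pi.single 0 d, v) 0 0 0 (2 * sdot u v) :=
  (jet_fiber_sq (x, Pi.single 0 σ) (Pi.single 0 c, u) (Pi.single 0 d, v)).cast
    (by simp) (by simp) (by simp) rfl

theorem jet_pole_time :
    HasJet (fun q : Tangent n => q.2 0) (x, Pi.single 0 σ) (Pi.single 0 c, u)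
      (Pi.single 0 d, v) σ (u 0) (v 0) 0 :=
  (jet_fiber_coord (x, Pi.single 0 σ) (Pi.single 0 c, u) (Pi.single 0 d, v) 0).cast
    (by simp) rfl rfl rfl

variable {A A' B B' : ℝ}

/-- The coefficients at the radius of `x`, for the jets at the point `(x, y)` with `y = σ ∂/∂x⁰`,
`σ = ± 1` (the pole): the values `A`, `A'`, `B`, `B'` of `a`, `a'`, `b`, `b'`, with the regularity
and positivity that the jets need. -/
structure PoleData (x : Fin (n + 1) → ℝ) (a b : ℝ → ℝ) (ε σ A A' B B' : ℝ) : Prop where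
  smooth_a : ContDiffAt ℝ 2 a (sdot x x)
  smooth_a' : ContDiffAt ℝ 2 (deriv a) (sdot x x)
  smooth_b : ContDiffAt ℝ 2 b (sdot x x)
  smooth_b' : ContDiffAt ℝ 2 (deriv b) (sdot x x)
  val_a : a (sdot x x) = A
  val_a' : deriv a (sdot x x) = A'
  val_b : b (sdot x x) = B
  val_b' : deriv b (sdot x x) = B'
  pos_a : 0 < A
  pos_b : 0 < B
  sign : σ = 1 ∨ σ = -1
  lt : 0 < 1 + ε * σ

namespace PoleData

theorem jet_norm (H : PoleData x a b ε σ A A' B B') :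
    HasJet (fun q : Tangent n => √(riemSq a b q.1 q.2)) (x, Pi.single 0 σ) (Pi.single 0 c, u)
      (Pi.single 0 d, v) A (A * σ * u 0) (A * σ * v 0) (B * sdot u v / A) := by
  have hA := H.pos_a
  have ja := (jet_pole_radial (σ := σ) (c := c) (u := u) (d := d) (v := v) H.smooth_a).cast
    H.val_a rfl rfl rfl
  have jb := (jet_pole_radial (σ := σ) (c := c) (u := u) (d := d) (v := v) H.smooth_b).cast
    H.val_b rfl rfl rfl
  have jay := ja.mul (jet_pole_time (x := x) (c := c) (u := u) (d := d) (v := v))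
  have jQ : HasJet (fun q : Tangent n => riemSq a b q.1 q.2) (x, Pi.single 0 σ) (Pi.single 0 c, u)
      (Pi.single 0 d, v) (A ^ 2) (2 * A ^ 2 * σ * u 0) (2 * A ^ 2 * σ * v 0)
      (2 * A ^ 2 * u 0 * v 0 + 2 * B * sdot u v) := by
    refine (((jay.mul jay).add (jb.mul jet_pole_fiber_sq)).cast ?_ ?_ ?_ ?_).congr
      (Filter.Eventually.of_forall fun q => ?_)
    · rcases H.sign with rfl | rfl <;> ring
    · ring
    · ring
    · ring
    · simp only [riemSq]; ring
  refine (jQ.sqrt hA rfl).cast rfl ?_ ?_ ?_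
  · field_simp
  · field_simp
  · rcases H.sign with rfl | rfl <;> · field_simp; ring

/-- At the pole, `P` is `-(ε σ a' / a) ⟨x̄, ȳ⟩` to second order: the vertical derivatives of the
factor `y⁰ / F` vanish there. -/
theorem jet_sprayP (H : PoleData x a b ε σ A A' B B') :
    HasJet (onPairs (sprayP ε a b)) (x, Pi.single 0 σ) (Pi.single 0 c, u)
      (Pi.single 0 d, v) 0 (-(ε * σ * A' / A) * sdot x u) (-(ε * σ * A' / A) * sdot x v) 0 := by
  have hA := H.pos_a
  have hε := H.lt.ne'
  have ja := (jet_pole_radial (σ := σ) (c := c) (u := u) (d := d) (v := v) H.smooth_a).cast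
    H.val_a rfl rfl rfl
  have ja' := (jet_pole_radial (σ := σ) (c := c) (u := u) (d := d) (v := v) H.smooth_a').cast
    H.val_a' rfl rfl rfl
  have jy := jet_pole_time (x := x) (σ := σ) (c := c) (u := u) (d := d) (v := v)
  have jF := (H.jet_norm (c := c) (u := u) (d := d) (v := v)).add ((ja.const_mul ε).mul jy)
  have hF : A + ε * A * σ ≠ 0 := by
    rw [show A + ε * A * σ = A * (1 + ε * σ) by ring]; exact mul_ne_zero hA.ne' hε
  have j1 := (jy.div jF hF).const_mul (-(ε * (1 - ε ^ 2)))
  have j2 := ((ja'.mul j1).add (((ja'.div ja hA.ne').const_mul (-ε ^ 2)))).cast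
    (h' := -(ε * σ * A' / A)) (hu' := 0) (hv' := 0) ?_ ?_ ?_ rfl
  · refine ((jet_pole_cross.mul j2).cast (by ring) (by ring) (by ring) (by ring)).congr
      (Filter.Eventually.of_forall fun q => ?_)
    simp only [onPairs, sprayP, randers]
    ring
  all_goals
    rcases H.sign with rfl | rfl
    · have h1 : 1 + ε ≠ 0 := by simpa using hε
      have h2 : A + ε * A ≠ 0 := by simpa using hF
      simp only [mul_one]
      rw [show A + ε * A = A * (1 + ε) by ring]
      field_simp
      ring
    · have h1 : 1 - ε ≠ 0 := by simpa [sub_eq_add_neg] using hε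
      rw [show A + ε * A * -1 = A * (1 - ε) by ring]
      field_simp
      ring

/-- At the pole, `G⁰` is the product of `⟨x̄, ȳ⟩` with `2 a' y⁰ / a`, to second order. -/
theorem jet_sprayTime (H : PoleData x a b ε σ A A' B B') :
    HasJet (onPairs (sprayTime ε a b)) (x, Pi.single 0 σ) (Pi.single 0 c, u)
      (Pi.single 0 d, v) 0 (2 * A' / A * σ * sdot x u) (2 * A' / A * σ * sdot x v)
      (2 * A' / A * (sdot x u * v 0 + sdot x v * u 0)) := by
  have hA := H.pos_a
  have ja := (jet_pole_radial (σ := σ) (c := c) (u := u) (d := d) (v := v) H.smooth_a).cast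
    H.val_a rfl rfl rfl
  have ja' := (jet_pole_radial (σ := σ) (c := c) (u := u) (d := d) (v := v) H.smooth_a').cast
    H.val_a' rfl rfl rfl
  have jy := jet_pole_time (x := x) (σ := σ) (c := c) (u := u) (d := d) (v := v)
  have jt := jet_pole_cross (x := x) (σ := σ) (c := c) (u := u) (d := d) (v := v)
  have jk := (ja'.div ja hA.ne').cast rfl (hu' := 0) (hv' := 0) (huv' := 0)
    (by simp) (by simp) (by simp)
  have jk2 := (jk.div ja hA.ne').cast rfl (hu' := 0) (hv' := 0) (huv' := 0)
    (by simp) (by simp) (by simp)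
  refine (((jy.mul (((jk.mul jt).const_mul 2).add H.jet_sprayP)).add
    (((H.jet_norm.mul jk2).mul jt).const_mul ε)).cast ?_ ?_ ?_ ?_).congr
      (Filter.Eventually.of_forall fun q => ?_)
  · ring
  · rcases H.sign with rfl | rfl <;> · field_simp; ring
  · rcases H.sign with rfl | rfl <;> · field_simp; ring
  · rcases H.sign with rfl | rfl <;> · field_simp; ring
  · simp only [onPairs, sprayTime]
    ring

theorem jet_sprayV (H : PoleData x a b ε σ A A' B B') :
    HasJet (onPairs (sprayV ε a b)) (x, Pi.single 0 σ) (Pi.single 0 c, u)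
      (Pi.single 0 d, v) (A * A' / B * (1 + ε * σ)) (2 * (A * A' / B) * (σ + ε) * u 0)
      (2 * (A * A' / B) * (σ + ε) * v 0)
      ((B' / B + ε * σ * A' / A) * sdot u v + 2 * (A * A' / B) * (1 + ε * σ) * (u 0 * v 0)) := by
  have hA := H.pos_a
  have hB := H.pos_b
  have ja := (jet_pole_radial (σ := σ) (c := c) (u := u) (d := d) (v := v) H.smooth_a).cast
    H.val_a rfl rfl rfl
  have ja' := (jet_pole_radial (σ := σ) (c := c) (u := u) (d := d) (v := v) H.smooth_a').cast
    H.val_a' rfl rfl rfl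
  have jb := (jet_pole_radial (σ := σ) (c := c) (u := u) (d := d) (v := v) H.smooth_b).cast
    H.val_b rfl rfl rfl
  have jb' := (jet_pole_radial (σ := σ) (c := c) (u := u) (d := d) (v := v) H.smooth_b').cast
    H.val_b' rfl rfl rfl
  have jy := jet_pole_time (x := x) (σ := σ) (c := c) (u := u) (d := d) (v := v)
  have jw := jet_pole_fiber_sq (x := x) (σ := σ) (c := c) (u := u) (d := d) (v := v)
  have jk := (ja'.div jb hB.ne').cast rfl (hu' := 0) (hv' := 0) (huv' := 0)
    (by simp) (by simp) (by simp)
  have jl := (jb'.div jb hB.ne').cast rfl (hu' := 0) (hv' := 0) (huv' := 0)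
    (by simp) (by simp) (by simp)
  refine ((((jl.mul jw).const_mul (1 / 2)).add (((ja.mul jk).mul (jy.mul jy)).add
    ((jk.mul (H.jet_norm.mul jy)).const_mul ε))).cast ?_ ?_ ?_ ?_).congr
      (Filter.Eventually.of_forall fun q => ?_)
  · rcases H.sign with rfl | rfl <;> · field_simp; ring
  · rcases H.sign with rfl | rfl <;> · field_simp; ring
  · rcases H.sign with rfl | rfl <;> · field_simp; ring
  · rcases H.sign with rfl | rfl <;> · field_simp; ring
  · simp only [onPairs, sprayV]
    ring

theorem jet_spraySpace (H : PoleData x a b ε σ A A' B B') (j : Fin n) :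
    HasJet (onPairs (spraySpace ε a b j)) (x, Pi.single 0 σ) (Pi.single 0 c, u)
      (Pi.single 0 d, v) (-(A * A' / B * (1 + ε * σ)) * x j.succ)
      (-(2 * (A * A' / B) * (σ + ε) * u 0) * x j.succ)
      (-(2 * (A * A' / B) * (σ + ε) * v 0) * x j.succ)
      ((B' / B - ε * σ * A' / A) * (sdot x u * v j.succ + sdot x v * u j.succ)
        - ((B' / B + ε * σ * A' / A) * sdot u v
          + 2 * (A * A' / B) * (1 + ε * σ) * (u 0 * v 0)) * x j.succ) := by
  have hB := H.pos_b
  have jb := (jet_pole_radial (σ := σ) (c := c) (u := u) (d := d) (v := v) H.smooth_b).cast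
    H.val_b rfl rfl rfl
  have jb' := (jet_pole_radial (σ := σ) (c := c) (u := u) (d := d) (v := v) H.smooth_b').cast
    H.val_b' rfl rfl rfl
  have jt := jet_pole_cross (x := x) (σ := σ) (c := c) (u := u) (d := d) (v := v)
  have jl := (jb'.div jb hB.ne').cast rfl (hu' := 0) (hv' := 0) (huv' := 0)
    (by simp) (by simp) (by simp)
  have jx := (jet_base_coord (x, Pi.single 0 σ) (Pi.single 0 c, u) (Pi.single 0 d, v) j.succ).cast
    (h' := x j.succ) (hu' := 0) (hv' := 0) rfl (by simp) (by simp) rfl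
  have jy := (jet_fiber_coord (x, Pi.single 0 σ) (Pi.single 0 c, u) (Pi.single 0 d, v)
    j.succ).cast (h' := 0) (by simp) rfl rfl rfl
  refine (((((jl.mul jt).add H.jet_sprayP).mul jy).sub (H.jet_sprayV.mul jx)).cast
    ?_ ?_ ?_ ?_).congr (Filter.Eventually.of_forall fun q => ?_)
  · ring
  · ring
  · ring
  · ring
  · simp only [onPairs, spraySpace]
    ring

end PoleData

theorem pole_ne_zero (hσ : σ = 1 ∨ σ = -1) : (Pi.single 0 σ : Fin (n + 1) → ℝ) ≠ 0 := by
  rw [Ne, Pi.single_eq_zero_iff]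
  rcases hσ with rfl | rfl <;> norm_num

/-- The Ricci curvature in the direction `σ ∂/∂x⁰`. The first summand, the only one with a second
derivative of `a`, depends on the sign `σ` only through the factor `1 + ε σ`. -/
theorem IsRadialRanders.ricci_pole {J : Set ℝ} {F : (Fin (n + 1) → ℝ) → (Fin (n + 1) → ℝ) → ℝ}
    (H : IsRadialRanders J ε a b F) (hx : sdot x x ∈ J) (hσ : σ = 1 ∨ σ = -1)
    (hA : a (sdot x x) = A) (hA' : deriv a (sdot x x) = A') (hB : b (sdot x x) = B)
    (hB' : deriv b (sdot x x) = B') :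
    ricci F x (Pi.single 0 σ) = (1 + ε * σ) *
      (-2 * (∑ j : Fin n, fderiv ℝ (fun x' : Fin (n + 1) → ℝ => a (sdot x' x')
          * deriv a (sdot x' x') / b (sdot x' x') * x' j.succ) x (Pi.single j.succ 1))
        + A * A' / B * sdot x x
          * (4 * A' / A - 2 * n * B' / B + 2 * (n + 2) * (ε * σ) * A' / A)) := by
  have hy := pole_ne_zero (n := n) hσ
  have h1 : 0 < 1 + ε * σ := by
    have := _root_.abs_lt.mp H.abs_lt
    rcases hσ with rfl | rfl <;> linarith
  have hApos : 0 < A := hA ▸ H.pos_a _ hx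
  have hBpos : 0 < B := hB ▸ H.pos_b _ hx
  obtain ⟨ca, ca'⟩ := contDiffAt_deriv_of_contDiffOn H.isOpen H.smooth_a hx
  obtain ⟨cb, cb'⟩ := contDiffAt_deriv_of_contDiffOn H.isOpen H.smooth_b hx
  have D : PoleData x a b ε σ A A' B B' :=
    ⟨ca, ca', cb, cb', hA, hA', hB, hB', hApos, hBpos, hσ, h1⟩
  have J0 := fun c d u v =>
    (D.jet_sprayTime (c := c) (d := d) (u := u) (v := v)).congr (H.spray_time_eventuallyEq hx hy)
  have Js := fun (j : Fin n) c d u v =>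
    (D.jet_spraySpace (c := c) (d := d) (u := u) (v := v) j).congr
      (H.spray_space_eventuallyEq hx hy j)
  have hS : ∀ C, ContDiffAt ℝ 2 (onPairs (spray F C)) (x, Pi.single 0 σ) := fun C =>
    Fin.cases (J0 0 0 0 0).smooth (fun j => (Js j 0 0 0 0).smooth) C
  set V := A * A' / B * (1 + ε * σ) with hV
  set G : Fin (n + 1) → ℝ := Fin.cons 0 fun j => 0 * x j.succ - V * x j.succ with hG
  have hSG : ∀ C, spray F C x (Pi.single 0 σ) = G C := fun C =>
    Fin.cases (J0 0 0 0 0).val (fun j => (Js j 0 0 0 0).val.trans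
      (by simp only [hG, Fin.cons_succ]; ring)) C
  have hzG : ∀ z, sdot z G = -V * sdot z x := fun z =>
    (sdot_cons_space _ _ _ x x z).trans (by ring)
  have hG0 : G 0 = 0 := rfl
  have hGs : ∀ j : Fin n, G j.succ = -V * x j.succ := fun j => by
    simp only [hG, Fin.cons_succ]; ring
  have d0 : ∀ i, fderiv ℝ (onPairs (spray F 0)) (x, Pi.single 0 σ) (0, Pi.single i 1)
      = 2 * A' / A * σ * sdot x (Pi.single i 1) := fun i => by
    have := (J0 0 0 0 (Pi.single i 1)).dv
    rwa [Pi.single_zero] at this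
  have ds : ∀ (j : Fin n) i, fderiv ℝ (onPairs (spray F j.succ)) (x, Pi.single 0 σ)
      (0, Pi.single i 1) = -(2 * (A * A' / B) * (σ + ε) * (Pi.single i 1 : Fin (n + 1) → ℝ) 0)
        * x j.succ := fun j i => by
    have := (Js j 0 0 0 (Pi.single i 1)).dv
    rwa [Pi.single_zero] at this
  have hdx0 : fderiv ℝ (onPairs (spray F 0)) (x, Pi.single 0 σ) (Pi.single 0 1, 0) = 0 := by
    have := (J0 1 0 0 0).du
    rwa [sdot_zero_right, mul_zero] at this
  have hdxs : ∀ j : Fin n, fderiv ℝ (onPairs (spray F j.succ)) (x, Pi.single 0 σ)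
      (Pi.single j.succ 1, 0) = -(1 + ε * σ) * fderiv ℝ (fun x' : Fin (n + 1) → ℝ =>
        a (sdot x' x') * deriv a (sdot x' x') / b (sdot x' x') * x' j.succ) x
          (Pi.single j.succ 1) := by
    intro j
    rw [← pdx_eq_fderiv ((hS j.succ).differentiableAt (by simp))]
    have e : (fun x' => spray F j.succ x' (Pi.single 0 σ)) =ᶠ[nhds x] fun x' =>
        -(1 + ε * σ) * (a (sdot x' x') * deriv a (sdot x' x') / b (sdot x' x') * x' j.succ) := by
      filter_upwards [(H.isOpen.preimage continuous_sdot_self).mem_nhds hx] with x' hx'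
      have hx'' : sdot x' x' ∈ J := hx'
      obtain ⟨ca, ca'⟩ := contDiffAt_deriv_of_contDiffOn H.isOpen H.smooth_a hx''
      obtain ⟨cb, cb'⟩ := contDiffAt_deriv_of_contDiffOn H.isOpen H.smooth_b hx''
      have D' : PoleData x' a b ε σ _ _ _ _ :=
        ⟨ca, ca', cb, cb', rfl, rfl, rfl, rfl, H.pos_a _ hx'', H.pos_b _ hx'', hσ, h1⟩
      have := ((D'.jet_spraySpace (c := 0) (d := 0) (u := 0) (v := 0) j).congr
        (H.spray_space_eventuallyEq hx'' hy j)).val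
      refine this.trans ?_
      ring
    unfold pdx
    rw [e.fderiv_eq]
    have hd : DifferentiableAt ℝ (fun x' : Fin (n + 1) → ℝ =>
        a (sdot x' x') * deriv a (sdot x' x') / b (sdot x' x') * x' j.succ) x := by
      have hs : DifferentiableAt ℝ (fun x' : Fin (n + 1) → ℝ => sdot x' x') x := by
        unfold sdot; fun_prop
      have t : ∀ {φ : ℝ → ℝ}, ContDiffAt ℝ 2 φ (sdot x x) →
          DifferentiableAt ℝ (fun x' : Fin (n + 1) → ℝ => φ (sdot x' x')) x := fun h =>
        DifferentiableAt.comp (f := fun x' => sdot x' x') x (h.differentiableAt (by simp)) hs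
      have h1 := ((t ca).fun_mul (t ca')).fun_mul ((t cb).fun_inv (H.pos_b _ hx).ne')
      have h2 : DifferentiableAt ℝ (fun x' : Fin (n + 1) → ℝ => x' j.succ) x := by fun_prop
      simpa only [div_eq_mul_inv] using h1.fun_mul h2
    rw [fderiv_const_mul hd]
    rfl
  have dd0 : secondDeriv (onPairs (spray F 0)) (x, Pi.single 0 σ)
      (-Pi.single 0 σ, (2 : ℝ) • G) (0, Pi.single 0 1) = -4 * A' / A * V * sdot x x := by
    have := (J0 (-σ) 0 ((2 : ℝ) • G) (Pi.single 0 1)).duv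
    rw [Pi.single_zero, Pi.single_neg] at this
    refine this.trans ?_
    simp only [sdot_smul_right, hzG, Pi.single_eq_same, sdot_single_zero]
    ring
  have dds : ∀ j : Fin n, secondDeriv (onPairs (spray F j.succ)) (x, Pi.single 0 σ)
      (-Pi.single 0 σ, (2 : ℝ) • G) (0, Pi.single j.succ 1)
      = -2 * V * ((B' / B - ε * σ * A' / A) * (sdot x x + x j.succ * x j.succ)
        - (B' / B + ε * σ * A' / A) * (x j.succ * x j.succ)) := by
    intro j
    have := (Js j (-σ) 0 ((2 : ℝ) • G) (Pi.single j.succ 1)).duv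
    rw [Pi.single_zero, Pi.single_neg] at this
    refine this.trans ?_
    simp only [sdot_smul_right, hzG, Pi.single_eq_same, sdot_single_succ, Pi.smul_apply, hGs, hG0,
      smul_eq_mul]
    ring
  have K0 : flagCurvature F 0 0 x (Pi.single 0 σ) = 4 * (A * A' / B) * σ * (σ + ε) * (A' / A)
        * sdot x x - 4 * A' / A * V * sdot x x := by
    rw [flagCurvature_eq hS hSG, hdx0, dd0, Fin.sum_univ_succ]
    simp only [d0, ds, sdot_single_zero, sdot_single_succ, Pi.single_eq_same]
    have : ∀ j : Fin n, 2 * A' / A * σ * (x j.succ * 1) *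
        (-(2 * (A * A' / B) * (σ + ε) * 1) * x j.succ)
        = -(4 * (A * A' / B) * σ * (σ + ε) * (A' / A)) * (x j.succ * x j.succ) := fun j => by
      ring
    simp only [this, ← Finset.mul_sum]
    simp only [← sdot_def]
    ring
  have Kj : ∀ j : Fin n, flagCurvature F j.succ j.succ x (Pi.single 0 σ)
      = -2 * (1 + ε * σ) * fderiv ℝ (fun x' : Fin (n + 1) → ℝ =>
        a (sdot x' x') * deriv a (sdot x' x') / b (sdot x' x') * x' j.succ) x
          (Pi.single j.succ 1)
      + (-2 * V * ((B' / B - ε * σ * A' / A) * (sdot x x + x j.succ * x j.succ)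
        - (B' / B + ε * σ * A' / A) * (x j.succ * x j.succ)))
      + 4 * (A * A' / B) * σ * (σ + ε) * (A' / A) * (x j.succ * x j.succ) := by
    intro j
    rw [flagCurvature_eq hS hSG, hdxs, dds, Fin.sum_univ_succ]
    simp only [d0, ds, sdot_single_succ, Pi.single_eq_same]
    have e1 : ∀ i : Fin n, (Pi.single i.succ 1 : Fin (n + 1) → ℝ) 0 = 0 := fun i => by simp
    simp only [e1, mul_zero, neg_zero, zero_mul, Finset.sum_const_zero, hV]
    ring
  unfold ricci
  rw [Fin.sum_univ_succ, K0]
  simp only [Kj, Finset.sum_add_distrib, Finset.sum_sub_distrib, ← Finset.mul_sum,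
    Finset.sum_const, Finset.card_univ, Fintype.card_fin, nsmul_eq_mul]
  simp only [← sdot_def]
  have hs : σ * (σ + ε) = 1 + ε * σ := by
    rcases hσ with rfl | rfl <;> ring
  rw [hV]
  linear_combination 8 * (A * A' / B) * (A' / A) * sdot x x * hs

/-- Ricci-flatness in the two directions `± ∂/∂x⁰` forces `a` to be constant. -/
theorem IsRadialRanders.deriv_eq_zero_of_ricci_eq_zero {J : Set ℝ}
    {F : (Fin (n + 1) → ℝ) → (Fin (n + 1) → ℝ) → ℝ} (H : IsRadialRanders J ε a b F) (hε : ε ≠ 0)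
    (hx : sdot x x ∈ J) (hx0 : sdot x x ≠ 0)
    (hR : ∀ y : Fin (n + 1) → ℝ, y ≠ 0 → ricci F x y = 0) : deriv a (sdot x x) = 0 := by
  have h := fun σ hσ => (H.ricci_pole (σ := σ) hx hσ rfl rfl rfl rfl).symm.trans
    (hR _ (pole_ne_zero hσ))
  have hb := _root_.abs_lt.mp H.abs_lt
  -- After division by `1 + ε σ`, the curvatures for `σ = 1` and `σ = -1` differ by a nonzero
  -- multiple of `a' ^ 2`.
  have hp := (mul_eq_zero.mp (h 1 (Or.inl rfl))).resolve_left (by linarith)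
  have hm := (mul_eq_zero.mp (h (-1) (Or.inr rfl))).resolve_left (by linarith)
  have ha := (H.pos_a _ hx).ne'
  have hb := (H.pos_b _ hx).ne'
  by_contra h0
  have hn : (n : ℝ) + 2 ≠ 0 := by positivity
  have e : 4 * ε * (n + 2) * sdot x x * deriv a (sdot x x) ^ 2 / b (sdot x x) = 0 := by
    rw [← sub_eq_zero.mpr (hp.trans hm.symm)]
    field_simp
    ring
  have : 4 * ε * (n + 2) * sdot x x * deriv a (sdot x x) ^ 2 / b (sdot x x) ≠ 0 := by
    refine div_ne_zero (mul_ne_zero (mul_ne_zero (mul_ne_zero ?_ hn) hx0) (pow_ne_zero 2 h0)) hb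
    exact mul_ne_zero (by norm_num) hε
  exact this e

end Pole

/-! ### Warped metrics given by the ansatz -/

section Ansatz

variable {n : ℕ} {ε : ℝ} {f g : ℝ → ℝ} {I : Set ℝ}

/-- A coefficient function of the radius `ρ`, as a function of `ρ²`. -/
noncomputable def ofSq (φ : ℝ → ℝ) (s : ℝ) : ℝ := φ √s

/-- The Randers metric of the ansatz. -/
noncomputable def ansatz (ε : ℝ) (f g : ℝ → ℝ) : (Fin (n + 1) → ℝ) → (Fin (n + 1) → ℝ) → ℝ :=
  randers ε (ofSq fun ρ => exp (f ρ / 2)) (ofSq fun ρ => exp (g ρ))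

theorem mem_shell {x : Fin (n + 1) → ℝ} : x ∈ shell n I ↔ sdot x x ∈ {s | √s ∈ I} := by
  simp [shell, spatialNorm_eq]

theorem isOpen_sqrt_preimage (hI : IsOpen I) : IsOpen {s : ℝ | √s ∈ I} :=
  hI.preimage Real.continuous_sqrt

theorem pos_of_sqrt_mem (hI : I ⊆ Set.Ioi 0) {s : ℝ} (hs : √s ∈ I) : 0 < s :=
  Real.sqrt_pos.mp (hI hs)

theorem contDiffOn_ofSq (hI : I ⊆ Set.Ioi 0) {φ : ℝ → ℝ} (hφ : ContDiffOn ℝ ∞ φ I) :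
    ContDiffOn ℝ ∞ (ofSq φ) {s | √s ∈ I} :=
  hφ.comp (fun _ hs => (Real.contDiffAt_sqrt (pos_of_sqrt_mem hI hs).ne').contDiffWithinAt)
    fun _ hs => hs

theorem isOpen_shell (hI : IsOpen I) : IsOpen (shell n I) := by
  have : shell n I = (fun x => sdot x x) ⁻¹' {s | √s ∈ I} := by ext x; exact mem_shell
  rw [this]
  exact (isOpen_sqrt_preimage hI).preimage continuous_sdot_self

/-- The expression `|ȳ| √φ(z, ρ)` of the ansatz is the Randers metric. -/
theorem spatialNorm_mul_sqrt_randersPhi (hε : |ε| < 1) (x : Fin (n + 1) → ℝ)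
    {y : Fin (n + 1) → ℝ} (hy : spatialNorm y ≠ 0) :
    spatialNorm y * √(randersPhi ε f g (y 0 / spatialNorm y) (spatialNorm x))
      = ansatz ε f g x y := by
  have hN : 0 < spatialNorm y := lt_of_le_of_ne (Real.sqrt_nonneg _) hy.symm
  have hN2 : spatialNorm y ^ 2 = sdot y y := by
    rw [spatialNorm_eq, Real.sq_sqrt (sdot_self_nonneg y)]
  have hy0 : y ≠ 0 := by
    rintro rfl
    simp [spatialNorm_eq] at hy
  have hpos : 0 < ansatz ε f g x y :=
    randers_pos hε (Real.exp_pos _) (Real.exp_pos _) hy0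
  have key : spatialNorm y * (√(exp (f (spatialNorm x)) * (y 0 / spatialNorm y) ^ 2
      + exp (g (spatialNorm x))) + ε * exp (f (spatialNorm x) / 2) * (y 0 / spatialNorm y))
      = ansatz ε f g x y := by
    have hexp : exp (f (spatialNorm x)) = exp (f (spatialNorm x) / 2) ^ 2 := by
      rw [← Real.exp_nat_mul]; ring_nf
    have e1 : spatialNorm y * √(exp (f (spatialNorm x)) * (y 0 / spatialNorm y) ^ 2
        + exp (g (spatialNorm x))) = √(riemSq (ofSq fun ρ => exp (f ρ / 2))
          (ofSq fun ρ => exp (g ρ)) x y) := by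
      rw [← Real.sqrt_sq hN.le, ← Real.sqrt_mul (sq_nonneg _), Real.sqrt_sq hN.le]
      congr 1
      simp only [riemSq, ofSq, ← spatialNorm_eq, ← hN2]
      rw [hexp]
      field_simp
    rw [mul_add, e1]
    simp only [ansatz, randers]
    rw [add_right_inj]
    simp only [ofSq, ← spatialNorm_eq]
    field_simp
  -- The square root in `√φ` undoes the square because `F` is positive.
  rw [← key] at hpos ⊢
  rw [randersPhi, Real.sqrt_sq (pos_of_mul_pos_right hpos hN.le).le]

theorem ansatz_homogeneous (x y : Fin (n + 1) → ℝ) {c : ℝ} (hc : 0 < c) :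
    ansatz ε f g x (c • y) = c * ansatz ε f g x y := by
  unfold ansatz randers
  have : riemSq (ofSq fun ρ => exp (f ρ / 2)) (ofSq fun ρ => exp (g ρ)) x (c • y)
      = c ^ 2 * riemSq (ofSq fun ρ => exp (f ρ / 2)) (ofSq fun ρ => exp (g ρ)) x y := by
    simp only [riemSq, sdot_smul_left, sdot_smul_right, Pi.smul_apply, smul_eq_mul]; ring
  rw [this, Real.sqrt_mul (sq_nonneg c), Real.sqrt_sq hc.le]
  simp only [Pi.smul_apply, smul_eq_mul]; ring

theorem continuous_ansatz (x : Fin (n + 1) → ℝ) :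
    Continuous fun y : Fin (n + 1) → ℝ => ansatz ε f g x y := by
  unfold ansatz randers riemSq sdot
  fun_prop

theorem contDiffOn_ansatz (hI0 : I ⊆ Set.Ioi 0) (hf : ContDiffOn ℝ ∞ f I)
    (hg : ContDiffOn ℝ ∞ g I) :
    ContDiffOn ℝ ∞ (fun p : Tangent n => ansatz ε f g p.1 p.2)
      {p | p.1 ∈ shell n I ∧ p.2 ≠ 0} := by
  have hs1 : ContDiff ℝ ∞ fun p : Tangent n => sdot p.1 p.1 := by
    unfold sdot; fun_prop
  have hs2 : ContDiff ℝ ∞ fun p : Tangent n => sdot p.2 p.2 := by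
    unfold sdot; fun_prop
  have h0 : ContDiff ℝ ∞ fun p : Tangent n => p.2 0 := by fun_prop
  have ha := (contDiffOn_ofSq hI0 (hf.div_const 2).exp).comp
    (t := {s | √s ∈ I}) (s := {p : Tangent n |
      p.1 ∈ shell n I ∧ p.2 ≠ 0}) hs1.contDiffOn (fun p hp => mem_shell.mp hp.1)
  have hb := (contDiffOn_ofSq hI0 hg.exp).comp
    (t := {s | √s ∈ I}) (s := {p : Tangent n |
      p.1 ∈ shell n I ∧ p.2 ≠ 0}) hs1.contDiffOn (fun p hp => mem_shell.mp hp.1)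
  have hQ := ((ha.pow 2).mul (h0.contDiffOn.pow 2)).add (hb.mul hs2.contDiffOn)
  refine (hQ.sqrt fun p hp => ?_).add ((contDiffOn_const.mul ha).mul h0.contDiffOn)
  exact (riemSq_pos (a := ofSq fun ρ => exp (f ρ / 2)) (b := ofSq fun ρ => exp (g ρ)) (x := p.1)
    (Real.exp_pos _) (Real.exp_pos _) hp.2).ne'

theorem isRadialRanders_of_eq {F : (Fin (n + 1) → ℝ) → (Fin (n + 1) → ℝ) → ℝ} (hε : |ε| < 1)
    (hI : IsOpen I) (hI0 : I ⊆ Set.Ioi 0) (hf : ContDiffOn ℝ ∞ f I) (hg : ContDiffOn ℝ ∞ g I)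
    (hF : ∀ x ∈ shell n I, ∀ y, F x y = ansatz ε f g x y)
    (hc : ∀ x ∈ shell n I, ∀ y, y ≠ 0 → (fundamentalTensor F x y).PosDef) :
    IsRadialRanders {s | √s ∈ I} ε (ofSq fun ρ => exp (f ρ / 2)) (ofSq fun ρ => exp (g ρ)) F where
  isOpen := isOpen_sqrt_preimage hI
  smooth_a := contDiffOn_ofSq hI0 (hf.div_const 2).exp
  smooth_b := contDiffOn_ofSq hI0 hg.exp
  pos_a _ _ := Real.exp_pos _
  pos_b _ _ := Real.exp_pos _
  abs_lt := hε
  eq_randers x hx := hF x (mem_shell.mpr hx)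
  convex x hx := hc x (mem_shell.mpr hx)

theorem isWarpedMetric_ansatz (hε : |ε| < 1) (hI : IsOpen I) (hI0 : I ⊆ Set.Ioi 0)
    (hf : ContDiffOn ℝ ∞ f I) (hg : ContDiffOn ℝ ∞ g I) :
    IsWarpedMetric n I (randersPhi ε f g) (ansatz ε f g) := by
  refine ⟨⟨contDiffOn_ansatz hI0 hf hg, ?_, ?_, ?_⟩, ?_⟩
  · exact fun x _ y hy => randers_pos hε (Real.exp_pos _) (Real.exp_pos _) hy
  · exact fun x _ y c hc => ansatz_homogeneous x y hc
  · intro x hx y hy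
    have hx' := mem_shell.mp hx
    exact fundamentalTensor_randers_posDef hε
      (contDiffAt_deriv_of_contDiffOn (isOpen_sqrt_preimage hI)
        (contDiffOn_ofSq hI0 (hf.div_const 2).exp) hx').1
      (contDiffAt_deriv_of_contDiffOn (isOpen_sqrt_preimage hI)
        (contDiffOn_ofSq hI0 hg.exp) hx').1 (Real.exp_pos _) (Real.exp_pos _) hy
  · exact fun x _ y hy => (spatialNorm_mul_sqrt_randersPhi hε x hy).symm

/-- The function `φ` determines `F` also at the vectors with `ȳ = 0`: by continuity at the nonzero
ones and by homogeneity at `0`. -/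
theorem IsWarpedMetric.eq_ansatz (hn : 1 ≤ n) (hε : |ε| < 1) (hI : IsOpen I)
    {F : (Fin (n + 1) → ℝ) → (Fin (n + 1) → ℝ) → ℝ} (hF : IsWarpedMetric n I (randersPhi ε f g) F)
    {x : Fin (n + 1) → ℝ} (hx : x ∈ shell n I) (y : Fin (n + 1) → ℝ) :
    F x y = ansatz ε f g x y := by
  have h1 : ∀ y, spatialNorm y ≠ 0 → F x y = ansatz ε f g x y := fun y hy =>
    (hF.2 x hx y hy).trans (spatialNorm_mul_sqrt_randersPhi hε x hy)
  by_cases hy : spatialNorm y = 0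
  swap
  · exact h1 y hy
  by_cases hy0 : y = 0
  · subst hy0
    have h2 := hF.1.homogeneous x hx 0 2 two_pos
    have h3 := ansatz_homogeneous (ε := ε) (f := f) (g := g) x 0 two_pos
    rw [smul_zero] at h2 h3
    linarith
  have hw : sdot y y = 0 := by
    rw [spatialNorm_eq] at hy
    exact (Real.sqrt_eq_zero (sdot_self_nonneg y)).mp hy
  set i : Fin n := ⟨0, hn⟩
  -- Along this line, `ȳ ≠ 0` except at `τ = 0`.
  set c : ℝ → Fin (n + 1) → ℝ := fun τ => y + τ • Pi.single i.succ 1 with hc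
  have hcc : Continuous c := by fun_prop
  have hc0 : c 0 = y := by simp [hc]
  have hopen : IsOpen {p : Tangent n | p.1 ∈ shell n I ∧ p.2 ≠ 0} :=
    ((isOpen_shell hI).preimage continuous_fst).inter (isOpen_ne.preimage continuous_snd)
  have hFc : ContinuousAt (fun p : Tangent n => F p.1 p.2) (x, c 0) :=
    hF.1.smooth.continuousOn.continuousAt (hopen.mem_nhds ⟨hx, by rwa [hc0]⟩)
  have hF1 : ContinuousAt (fun τ => F x (c τ)) 0 :=
    ContinuousAt.comp (f := fun τ => (x, c τ)) hFc (by fun_prop)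
  have hA1 : ContinuousAt (fun τ => ansatz ε f g x (c τ)) 0 :=
    ((continuous_ansatz x).comp hcc).continuousAt
  have e : (fun τ => F x (c τ)) =ᶠ[nhdsWithin 0 {0}ᶜ] fun τ => ansatz ε f g x (c τ) := by
    filter_upwards [self_mem_nhdsWithin] with τ hτ
    refine h1 _ fun h => hτ ?_
    rw [spatialNorm_eq, Real.sqrt_eq_zero (sdot_self_nonneg _)] at h
    have h4 := sdot_self_eq_zero h i
    have h5 := sdot_self_eq_zero hw i
    simpa [hc, h5] using h4
  have := tendsto_nhds_unique (hF1.tendsto.mono_left nhdsWithin_le_nhds)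
    ((hA1.tendsto.mono_left nhdsWithin_le_nhds).congr' e.symm)
  simpa [hc0] using this

/-- `F` is not reversible in the direction `∂/∂x⁰`, whereas a quadratic form is even. -/
theorem not_isRiemannianAt_of_eq (hε : ε ≠ 0) {F : (Fin (n + 1) → ℝ) → (Fin (n + 1) → ℝ) → ℝ}
    {x : Fin (n + 1) → ℝ} (hF : ∀ y, F x y = ansatz ε f g x y) : ¬ IsRiemannianAt F x := by
  rintro ⟨q, hq⟩
  -- Compare the values of `F²` at `∂/∂x⁰` and its negative.
  have h := (hq (Pi.single 0 1)).trans ((q.map_neg _).symm.trans (hq (-Pi.single 0 1)).symm)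
  simp only [hF, ansatz, randers, riemSq, Pi.single_eq_same, Pi.neg_apply, sdot_neg_right,
    sdot_single_zero, neg_zero, neg_sq, one_pow, mul_one, mul_zero, add_zero] at h
  have ha : 0 < ofSq (fun ρ => exp (f ρ / 2)) (sdot x x) := Real.exp_pos _
  rw [Real.sqrt_sq ha.le] at h
  have h2 : ε * ofSq (fun ρ => exp (f ρ / 2)) (sdot x x) ^ 2 = 0 := by linarith
  exact mul_ne_zero hε (pow_ne_zero 2 ha.ne') h2

theorem isRandersMetric_of_eq (hε : |ε| < 1) (hI0 : I ⊆ Set.Ioi 0)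
    (hf : ContDiffOn ℝ ∞ f I) (hg : ContDiffOn ℝ ∞ g I)
    {F : (Fin (n + 1) → ℝ) → (Fin (n + 1) → ℝ) → ℝ}
    (hF : ∀ x ∈ shell n I, ∀ y, F x y = ansatz ε f g x y) : IsRandersMetric (shell n I) F := by
  set a := ofSq fun ρ => exp (f ρ / 2)
  set b := ofSq fun ρ => exp (g ρ)
  have hs1 : ContDiff ℝ ∞ fun x : Fin (n + 1) → ℝ => sdot x x := by unfold sdot; fun_prop
  have ha : ContDiffOn ℝ ∞ (fun x : Fin (n + 1) → ℝ => a (sdot x x)) (shell n I) :=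
    (contDiffOn_ofSq hI0 (hf.div_const 2).exp).comp hs1.contDiffOn fun x hx => mem_shell.mp hx
  have hb : ContDiffOn ℝ ∞ (fun x : Fin (n + 1) → ℝ => b (sdot x x)) (shell n I) :=
    (contDiffOn_ofSq hI0 hg.exp).comp hs1.contDiffOn fun x hx => mem_shell.mp hx
  have pa : ∀ s, 0 < a s := fun s => Real.exp_pos _
  have pb : ∀ s, 0 < b s := fun s => Real.exp_pos _
  set d : (Fin (n + 1) → ℝ) → Fin (n + 1) → ℝ := fun x =>
    Fin.cons (a (sdot x x) ^ 2) fun _ => b (sdot x x) with hd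
  have hdpos : ∀ x i, 0 < d x i := fun x i =>
    Fin.cases (pow_pos (pa _) 2) (fun _ => pb _) i
  have hpd : ∀ x, (Matrix.diagonal (d x)).PosDef := fun x =>
    Matrix.PosDef.diagonal (hdpos x)
  refine ⟨fun x => Matrix.diagonal (d x), fun x => Pi.single 0 (ε * a (sdot x x)), ?_, ?_,
    fun x _ => hpd x, ?_, ?_⟩
  · intro A B
    by_cases h : A = B
    · subst h
      simp only [Matrix.diagonal_apply_eq]
      exact Fin.cases (ha.pow 2) (fun _ => hb) A
    · simp only [Matrix.diagonal_apply_ne _ h]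
      exact contDiffOn_const
  · intro A
    refine Fin.cases ?_ (fun j => ?_) A
    · simp only [Pi.single_eq_same]
      exact contDiffOn_const.mul ha
    · have : ∀ x : Fin (n + 1) → ℝ,
        (Pi.single 0 (ε * a (sdot x x)) : Fin (n + 1) → ℝ) j.succ = 0 := fun x => by simp
      simp only [this]
      exact contDiffOn_const
  · intro x _
    have hdet : IsUnit (Matrix.diagonal (d x)).det := isUnit_iff_ne_zero.mpr (hpd x).det_pos.ne'
    have e : (Pi.single 0 (ε * a (sdot x x)) : Fin (n + 1) → ℝ)
        = (Matrix.diagonal (d x)).mulVec (Pi.single 0 (ε / a (sdot x x))) := by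
      ext i
      rw [Matrix.mulVec_diagonal]
      refine Fin.cases ?_ (fun j => ?_) i
      · have := (pa (sdot x x)).ne'
        simp only [Pi.single_eq_same, hd, Fin.cons_zero]
        field_simp
      · simp
    have e2 : (Matrix.diagonal (d x))⁻¹.mulVec (Pi.single 0 (ε * a (sdot x x)))
        = Pi.single 0 (ε / a (sdot x x)) := by
      rw [e, Matrix.mulVec_mulVec, Matrix.nonsing_inv_mul _ hdet, Matrix.one_mulVec]
    rw [e2, single_dotProduct, Pi.single_eq_same]
    have := (pa (sdot x x)).ne'
    rw [show ε * a (sdot x x) * (ε / a (sdot x x)) = ε ^ 2 by field_simp]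
    exact (sq_lt_one_iff_abs_lt_one ε).mpr hε
  · intro x hx y
    rw [hF x hx y, single_dotProduct]
    unfold ansatz randers
    congr 2
    simp only [dotProduct, Matrix.mulVec_diagonal, Fin.sum_univ_succ, hd, Fin.cons_zero,
      Fin.cons_succ, riemSq, sdot, Finset.mul_sum]
    congr 1
    · ring
    · exact Finset.sum_congr rfl fun i _ => by ring

end Ansatz

/-! ### The differential equations for the coefficients -/

section Equations

variable {n : ℕ} {ε : ℝ} {f g a b : ℝ → ℝ} {I J : Set ℝ}

theorem sdot_single_succ_self (i : Fin n) (c : ℝ) :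
    sdot (Pi.single i.succ c : Fin (n + 1) → ℝ) (Pi.single i.succ c) = c ^ 2 := by
  simp [pow_two]

theorem single_succ_ne_zero (i : Fin n) {c : ℝ} (hc : c ≠ 0) :
    (Pi.single i.succ c : Fin (n + 1) → ℝ) ≠ 0 := by
  rwa [Ne, Pi.single_eq_zero_iff]

/-- Evaluation of the Ricci curvature at `x = √s e₁`, `y = e₁`. -/
theorem IsRadialRanders.radial_equation {F : (Fin (n + 1) → ℝ) → (Fin (n + 1) → ℝ) → ℝ}
    (H : IsRadialRanders J ε a b F) (h0 : ∀ s ∈ J, deriv a s = 0) (hn : 2 ≤ n)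
    (hR : ∀ x, sdot x x ∈ J → ∀ y, y ≠ 0 → ricci F x y = 0) {s : ℝ} (hs : s ∈ J) (hs0 : 0 < s) :
    deriv (fun s => deriv b s / b s) s * s + deriv b s / b s = 0 := by
  set i : Fin n := ⟨0, by omega⟩
  set x : Fin (n + 1) → ℝ := Pi.single i.succ √s with hx_def
  have hxx : sdot x x = s := by rw [hx_def, sdot_single_succ_self, Real.sq_sqrt hs0.le]
  have hx : sdot x x ∈ J := hxx.symm ▸ hs
  have hy := single_succ_ne_zero i (one_ne_zero (α := ℝ))
  have h := (H.ricci_eq_of_deriv_eq_zero h0 hx hy rfl rfl).symm.trans (hR x hx _ hy)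
  have hxy : sdot x (Pi.single i.succ 1) = √s := by simp [hx_def]
  rw [hxy, hxx, sdot_single_succ_self, Real.sq_sqrt hs0.le] at h
  have hn' : (n : ℝ) - 1 ≠ 0 := by
    have : (2 : ℝ) ≤ n := by exact_mod_cast hn
    linarith
  refine (mul_eq_zero.mp ?_).resolve_left hn'
  linear_combination (-1 / 2) * h

/-- Evaluation of the Ricci curvature at `x = √s e₁`, `y = e₂`. -/
theorem IsRadialRanders.tangential_equation {F : (Fin (n + 1) → ℝ) → (Fin (n + 1) → ℝ) → ℝ}
    (H : IsRadialRanders J ε a b F) (h0 : ∀ s ∈ J, deriv a s = 0) (hn : 2 ≤ n)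
    (hR : ∀ x, sdot x x ∈ J → ∀ y, y ≠ 0 → ricci F x y = 0) {s : ℝ} (hs : s ∈ J) (hs0 : 0 < s) :
    2 * deriv (fun s => deriv b s / b s) s * s + (2 * n - 2) * (deriv b s / b s)
      + ((n : ℝ) - 2) * (deriv b s / b s) ^ 2 * s = 0 := by
  set i : Fin n := ⟨0, by omega⟩
  set j : Fin n := ⟨1, by omega⟩
  set x : Fin (n + 1) → ℝ := Pi.single i.succ √s with hx_def
  have hxx : sdot x x = s := by rw [hx_def, sdot_single_succ_self, Real.sq_sqrt hs0.le]
  have hx : sdot x x ∈ J := hxx.symm ▸ hs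
  have hy := single_succ_ne_zero j (one_ne_zero (α := ℝ))
  have h := (H.ricci_eq_of_deriv_eq_zero h0 hx hy rfl rfl).symm.trans (hR x hx _ hy)
  have hij : j.succ ≠ i.succ := by simp [i, j]
  have hxy : sdot x (Pi.single j.succ 1) = 0 := by simp [hx_def, Pi.single_eq_of_ne hij]
  rw [hxy, hxx, sdot_single_succ_self] at h
  linear_combination -h

/-- For `a` constant and `b` a multiple of `s ^ c` (so that `b' / b = c / s`), the Ricci curvature
vanishes identically as soon as `(n - 2) c (c + 2) = 0`. -/
theorem IsRadialRanders.ricci_eq_of_power {F : (Fin (n + 1) → ℝ) → (Fin (n + 1) → ℝ) → ℝ}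
    (H : IsRadialRanders J ε a b F) (h0 : ∀ s ∈ J, deriv a s = 0) (hJ : ∀ s ∈ J, 0 < s) {c : ℝ}
    (hb : ∀ s ∈ J, deriv b s / b s = c / s) {x y : Fin (n + 1) → ℝ} (hx : sdot x x ∈ J)
    (hy : y ≠ 0) : ricci F x y
      = ((n : ℝ) - 2) * (c * (c + 2)) * (sdot x y ^ 2 - sdot x x * sdot y y) / sdot x x ^ 2 := by
  have hs := hJ _ hx
  have hd : deriv (fun s => deriv b s / b s) (sdot x x) = -c / sdot x x ^ 2 := by
    have e : (fun s => deriv b s / b s) =ᶠ[nhds (sdot x x)] fun s => c * s⁻¹ := by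
      filter_upwards [H.isOpen.mem_nhds hx] with s hs
      rw [hb s hs, div_eq_mul_inv]
    rw [e.deriv_eq, deriv_const_mul _ (differentiableAt_inv hs.ne'), deriv_inv]
    field_simp
  rw [H.ricci_eq_of_deriv_eq_zero h0 hx hy (hb _ hx) hd]
  field_simp
  ring

/-- On a line, the Cauchy–Schwarz inequality is an equality; hence the case `n = 1` imposes no
condition on `b`. -/
theorem sdot_sq_eq_of_one (hn : n = 1) (x y : Fin (n + 1) → ℝ) :
    sdot x y ^ 2 - sdot x x * sdot y y = 0 := by
  subst hn
  simp only [sdot, Fin.sum_univ_one]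
  ring

theorem exists_eq_of_deriv_eq_zero {φ : ℝ → ℝ} (hJ : IsOpen J) (hJ' : J.OrdConnected)
    (hne : J.Nonempty) (hd : ∀ s ∈ J, HasDerivAt φ 0 s) : ∃ c, ∀ s ∈ J, φ s = c := by
  obtain ⟨s₀, h₀⟩ := hne
  exact ⟨φ s₀, fun s hs => hJ.is_const_of_deriv_eq_zero hJ'.isPreconnected
    (fun t ht => (hd t ht).differentiableAt.differentiableWithinAt)
    (fun t ht => (hd t ht).deriv) hs h₀⟩

/-- Ricci-flatness of the ansatz in all dimensions: with `f` constant, the equations say that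
`g = β + C ln ρ`, where `C (C + 4) = 0` unless `n = 2`. -/
theorem isRicciFlat_iff (hn : 1 ≤ n) (hε : ε ≠ 0) (hI' : I.OrdConnected)
    (hne : I.Nonempty) (hI0 : I ⊆ Set.Ioi 0) (hg : ContDiffOn ℝ ∞ g I)
    {F : (Fin (n + 1) → ℝ) → (Fin (n + 1) → ℝ) → ℝ}
    (H : IsRadialRanders {s | √s ∈ I} ε (ofSq fun ρ => exp (f ρ / 2)) (ofSq fun ρ => exp (g ρ)) F) :
    IsRicciFlat (shell n I) F ↔ (∃ c, ∀ ρ ∈ I, f ρ = c) ∧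
      (n = 1 ∨ ∃ β C : ℝ, (∀ ρ ∈ I, g ρ = β + C * log ρ) ∧ (n = 2 ∨ C = 0 ∨ C = -4)) := by
  set a := ofSq fun ρ => exp (f ρ / 2) with ha
  set b := ofSq fun ρ => exp (g ρ) with hb
  set J : Set ℝ := {s | √s ∈ I} with hJ_def
  have hJpos : ∀ s ∈ J, 0 < s := fun s hs => pos_of_sqrt_mem hI0 hs
  have hJ' : J.OrdConnected := hI'.preimage_mono fun _ _ h => Real.sqrt_le_sqrt h
  have hsq : ∀ ρ ∈ I, ρ ^ 2 ∈ J ∧ √(ρ ^ 2) = ρ := fun ρ hρ => by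
    have h : √(ρ ^ 2) = ρ := Real.sqrt_sq (le_of_lt (hI0 hρ))
    exact ⟨show √(ρ ^ 2) ∈ I from h.symm ▸ hρ, h⟩
  have hJne : J.Nonempty := ⟨_, (hsq _ hne.some_mem).1⟩
  have hflat : IsRicciFlat (shell n I) F ↔ ∀ x, sdot x x ∈ J → ∀ y, y ≠ 0 → ricci F x y = 0 :=
    ⟨fun h x hx => h x (mem_shell.mpr hx), fun h x hx => h x (mem_shell.mp hx)⟩
  have hderiv : (∃ c, ∀ ρ ∈ I, f ρ = c) ↔ ∀ s ∈ J, deriv a s = 0 := by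
    constructor
    · rintro ⟨c, hc⟩ s hs
      have e : a =ᶠ[nhds s] fun _ => exp (c / 2) := by
        filter_upwards [H.isOpen.mem_nhds hs] with t ht
        rw [ha, ofSq, hc _ ht]
      rw [e.deriv_eq, deriv_const]
    · intro h
      have hd : ∀ s ∈ J, HasDerivAt a 0 s := fun s hs => by
        rw [← h s hs]
        exact ((H.smooth_a.contDiffAt (H.isOpen.mem_nhds hs)).differentiableAt
          (by simp)).hasDerivAt
      obtain ⟨c, hc⟩ := exists_eq_of_deriv_eq_zero H.isOpen hJ' hJne hd
      refine ⟨2 * log c, fun ρ hρ => ?_⟩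
      have := hc _ (hsq ρ hρ).1
      rw [ha, ofSq, (hsq ρ hρ).2] at this
      rw [← this, Real.log_exp]; ring
  have hlogderiv : ∀ s ∈ J, HasDerivAt (ofSq g) (deriv b s / b s) s := fun s hs => by
    have h1 : DifferentiableAt ℝ (ofSq g) s :=
      ((contDiffOn_ofSq hI0 hg).contDiffAt (H.isOpen.mem_nhds hs)).differentiableAt (by simp)
    have h2 : deriv b s = b s * deriv (ofSq g) s := h1.hasDerivAt.exp.deriv
    rw [h2, mul_div_cancel_left₀ _ (H.pos_b s hs).ne']
    exact h1.hasDerivAt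
  rw [hflat, hderiv]
  constructor
  · intro hR
    have h0 : ∀ s ∈ J, deriv a s = 0 := fun s hs => by
      have hxx := (sdot_single_succ_self (n := n) ⟨0, hn⟩ √s).trans (Real.sq_sqrt (hJpos s hs).le)
      have := H.deriv_eq_zero_of_ricci_eq_zero hε (hxx.symm ▸ hs) (hxx.symm ▸ (hJpos s hs).ne')
        (hR _ (hxx.symm ▸ hs))
      rwa [hxx] at this
    refine ⟨h0, (Nat.eq_or_lt_of_le hn).imp Eq.symm fun hn2 => ?_⟩
    set Γ := fun s => deriv b s / b s with hΓ
    -- The radial equation says that `s Γ(s)` is constant.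
    have hΓd : ∀ s ∈ J, HasDerivAt (fun s => s * Γ s) 0 s := fun s hs => by
      obtain ⟨cb, cb'⟩ := contDiffAt_deriv_of_contDiffOn H.isOpen H.smooth_b hs
      have h1 : DifferentiableAt ℝ Γ s :=
        (cb'.div cb (H.pos_b s hs).ne').differentiableAt (by simp)
      have h2 := (hasDerivAt_id s).fun_mul h1.hasDerivAt
      have h3 := H.radial_equation h0 hn2 hR hs (hJpos s hs)
      have h4 : 1 * Γ s + id s * deriv Γ s = 0 := by
        simp only [id]; linear_combination h3
      rw [h4] at h2
      exact h2
    obtain ⟨c, hc⟩ := exists_eq_of_deriv_eq_zero H.isOpen hJ' hJne hΓd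
    -- Since `Γ = (ln b)'`, this integrates to `ln b = c ln s + β`.
    have hgd : ∀ s ∈ J, HasDerivAt (fun s => ofSq g s - c * log s) 0 s := fun s hs => by
      have hs0 := (hJpos s hs).ne'
      have h1 := (hlogderiv s hs).fun_sub ((Real.hasDerivAt_log hs0).const_mul c)
      have h2 : deriv b s / b s - c * s⁻¹ = 0 := by
        rw [← hc s hs, hΓ]; field_simp; ring
      rwa [h2] at h1
    obtain ⟨β, hβ⟩ := exists_eq_of_deriv_eq_zero H.isOpen hJ' hJne hgd
    refine ⟨β, 2 * c, fun ρ hρ => ?_, ?_⟩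
    · have := hβ _ (hsq ρ hρ).1
      rw [ofSq, (hsq ρ hρ).2, Real.log_pow] at this
      push_cast at this
      linarith
    · refine (eq_or_ne n 2).imp id fun hn3 => ?_
      obtain ⟨s, hs⟩ := hJne
      have hs0 := hJpos s hs
      have h1 := H.radial_equation h0 hn2 hR hs hs0
      have h2 := H.tangential_equation h0 hn2 hR hs hs0
      have hn' : (n : ℝ) - 2 ≠ 0 := sub_ne_zero.mpr (by exact_mod_cast hn3)
      have h3 : c * (c + 2) = 0 := by
        refine (mul_eq_zero.mp (?_ : ((n : ℝ) - 2) * (c * (c + 2)) = 0)).resolve_left hn'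
        rw [← hc s hs, hΓ]
        linear_combination s * h2 - 2 * s * h1
      rcases mul_eq_zero.mp h3 with h | h
      · left; linarith
      · right; linarith
  · rintro ⟨h0, hcase⟩ x hx y hy
    rcases hcase with h1 | ⟨β, C, hgC, hC⟩
    · rw [H.ricci_eq_of_deriv_eq_zero h0 hx hy rfl rfl]
      have := sdot_sq_eq_of_one h1 x y
      have h1' : (n : ℝ) = 1 := by exact_mod_cast h1
      rw [h1']
      set k := deriv b (sdot x x) / b (sdot x x)
      set l := deriv (fun s => deriv b s / b s) (sdot x x)
      linear_combination (2 * l - k ^ 2) * this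
    · have hΓ : ∀ s ∈ J, deriv b s / b s = (C / 2) / s := fun s hs => by
        have e : ofSq g =ᶠ[nhds s] fun t => β + C / 2 * log t := by
          filter_upwards [H.isOpen.mem_nhds hs] with t ht
          rw [ofSq, hgC _ ht, Real.log_sqrt (hJpos t ht).le]
          ring
        have h1 := ((Real.hasDerivAt_log (hJpos s hs).ne').const_mul (C / 2)).const_add β
        rw [(hlogderiv s hs).unique (h1.congr_of_eventuallyEq e), div_eq_mul_inv (C / 2)]
      rw [H.ricci_eq_of_power h0 hJpos hΓ hx hy]
      have : ((n : ℝ) - 2) * (C / 2 * (C / 2 + 2)) = 0 := by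
        rcases hC with rfl | rfl | rfl <;> norm_num
      rw [this, zero_mul, zero_div]

end Equations

/-! ### Solutions in closed form -/

section Solutions

variable {n : ℕ} {ε : ℝ} {f g : ℝ → ℝ} {I : Set ℝ}

theorem isRicciFlat_iff_of_isWarpedMetric (hn : 1 ≤ n) (hε0 : ε ≠ 0) (hε : |ε| < 1) (hI : IsOpen I)
    (hI' : I.OrdConnected) (hne : I.Nonempty) (hI0 : I ⊆ Set.Ioi 0) (hf : ContDiffOn ℝ ∞ f I)
    (hg : ContDiffOn ℝ ∞ g I) {F : (Fin (n + 1) → ℝ) → (Fin (n + 1) → ℝ) → ℝ}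
    (hF : IsWarpedMetric n I (randersPhi ε f g) F) :
    IsRicciFlat (shell n I) F ↔ (∃ c, ∀ ρ ∈ I, f ρ = c) ∧
      (n = 1 ∨ ∃ β C : ℝ, (∀ ρ ∈ I, g ρ = β + C * log ρ) ∧ (n = 2 ∨ C = 0 ∨ C = -4)) :=
  isRicciFlat_iff hn hε0 hI' hne hI0 hg
    (isRadialRanders_of_eq hε hI hI0 hf hg (fun _ hx y => hF.eq_ansatz hn hε hI hx y)
      hF.1.stronglyConvex)

theorem log_mul_rpow_eq {B C ρ : ℝ} (hB : 0 < B) (hρ : 0 < ρ) :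
    log (B * ρ ^ C) = log B + C * log ρ := by
  rw [Real.log_mul hB.ne' (Real.rpow_pos_of_pos hρ C).ne', Real.log_rpow hρ]

theorem log_mul_zpow_eq {B ρ : ℝ} (hB : 0 < B) (hρ : 0 < ρ) :
    log (B * ρ ^ (-4 : ℤ)) = log B + -4 * log ρ := by
  rw [Real.log_mul hB.ne' (zpow_ne_zero _ hρ.ne'), Real.log_zpow]
  norm_num

/-- A choice of `f = ln A` and `g` that satisfies the equations gives a solution with the function
`φ` that it defines. -/
theorem isNonRiemannianRicciFlatSolution (hn : 1 ≤ n) (hε0 : ε ≠ 0) (hε : |ε| < 1) {A : ℝ}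
    (hA : 0 < A) (hg : ContDiffOn ℝ ∞ g (Set.Ioi 0)) {φ : ℝ → ℝ → ℝ}
    (hφ : ∀ z, ∀ ρ, 0 < ρ → φ z ρ = (√(A * z ^ 2 + exp (g ρ)) + ε * √A * z) ^ 2)
    (hsol : n = 1 ∨ ∃ β C : ℝ, (∀ ρ ∈ Set.Ioi (0 : ℝ), g ρ = β + C * log ρ) ∧
      (n = 2 ∨ C = 0 ∨ C = -4)) : IsNonRiemannianRicciFlatSolution n (Set.Ioi 0) φ := by
  set f : ℝ → ℝ := fun _ => log A with hf
  have hfc : ContDiffOn ℝ ∞ f (Set.Ioi 0) := contDiffOn_const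
  have hW : IsWarpedMetric n (Set.Ioi 0) (randersPhi ε f g) (ansatz ε f g) :=
    isWarpedMetric_ansatz hε isOpen_Ioi le_rfl hfc hg
  have hsqrt : exp (log A / 2) = √A := by
    rw [Real.sqrt_eq_rpow, Real.rpow_def_of_pos hA]; ring_nf
  refine ⟨ansatz ε f g, ⟨hW.1, fun x hx y hy => ?_⟩, ?_, fun x hx =>
    not_isRiemannianAt_of_eq hε0 fun y => rfl⟩
  · rw [hφ _ _ hx, hW.2 x hx y hy]
    simp only [randersPhi, hf, Real.exp_log hA, hsqrt]
  · exact (isRicciFlat_iff_of_isWarpedMetric hn hε0 hε isOpen_Ioi Set.ordConnected_Ioi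
      Set.nonempty_Ioi le_rfl hfc hg hW).mpr ⟨⟨log A, fun _ _ => rfl⟩, hsol⟩

end Solutions

end Finsler

theorem mainTheorem3 (ε : ℝ) (hε₀ : 0 < |ε|) (hε₁ : |ε| < 1) (n : ℕ) (hn : 1 ≤ n) :
    -- the ansatz, over an arbitrary nonempty open interval of radii
    (∀ (I : Set ℝ), IsOpen I → I.OrdConnected → I.Nonempty → I ⊆ Set.Ioi 0 →
      ∀ f g : ℝ → ℝ, ContDiffOn ℝ ∞ f I → ContDiffOn ℝ ∞ g I →
        (∃ F, Finsler.IsWarpedMetric n I (Finsler.randersPhi ε f g) F) ∧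
        ∀ F, Finsler.IsWarpedMetric n I (Finsler.randersPhi ε f g) F →
          Finsler.IsRandersMetric (Finsler.shell n I) F ∧
          (∀ x ∈ Finsler.shell n I, ¬ Finsler.IsRiemannianAt F x) ∧
          (3 ≤ n → (Finsler.IsRicciFlat (Finsler.shell n I) F ↔
            (∃ a, ∀ ρ ∈ I, f ρ = a) ∧
              ((∃ b, ∀ ρ ∈ I, g ρ = b) ∨
                ∃ B : ℝ, 0 < B ∧ ∀ ρ ∈ I, g ρ = Real.log (B * ρ ^ (-4 : ℤ))))) ∧
          (n = 2 → (Finsler.IsRicciFlat (Finsler.shell n I) F ↔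
            (∃ a, ∀ ρ ∈ I, f ρ = a) ∧
              ∃ B C : ℝ, 0 < B ∧ ∀ ρ ∈ I, g ρ = Real.log (B * ρ ^ C))) ∧
          (n = 1 → (Finsler.IsRicciFlat (Finsler.shell n I) F ↔
            ∃ a, ∀ ρ ∈ I, f ρ = a))) ∧
    -- the resulting explicit solutions on `ℝ × (ℝⁿ \ {0})`
    (3 ≤ n → ∀ A B : ℝ, 0 < A → 0 < B →
      Finsler.IsNonRiemannianRicciFlatSolution n (Set.Ioi 0)
        (fun z _ => (√(A * z ^ 2 + B) + ε * √A * z) ^ 2) ∧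
      Finsler.IsNonRiemannianRicciFlatSolution n (Set.Ioi 0)
        (fun z ρ => (√(A * z ^ 2 + B * ρ ^ (-4 : ℤ)) + ε * √A * z) ^ 2)) ∧
    (n = 2 → ∀ A B C : ℝ, 0 < A → 0 < B →
      Finsler.IsNonRiemannianRicciFlatSolution n (Set.Ioi 0)
        (fun z ρ => (√(A * z ^ 2 + B * ρ ^ C) + ε * √A * z) ^ 2)) ∧
    (n = 1 → ∀ A : ℝ, 0 < A → ∀ g : ℝ → ℝ, ContDiffOn ℝ ∞ g (Set.Ioi 0) →
      Finsler.IsNonRiemannianRicciFlatSolution n (Set.Ioi 0)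
        (fun z ρ => (√(A * z ^ 2 + Real.exp (g ρ)) + ε * √A * z) ^ 2)) := by
  have hε : ε ≠ 0 := abs_pos.mp hε₀
  refine ⟨fun I hI hI' hne hI0 f g hf hg => ⟨⟨_, Finsler.isWarpedMetric_ansatz hε₁ hI hI0 hf hg⟩,
    fun F hF => ?_⟩, fun h3 A B hA hB => ⟨?_, ?_⟩, fun h2 A B C hA hB => ?_,
    fun h1 A hA g hg => ?_⟩
  · have hFa := fun x (hx : x ∈ Finsler.shell n I) y => hF.eq_ansatz hn hε₁ hI hx y
    have key := Finsler.isRicciFlat_iff_of_isWarpedMetric hn hε hε₁ hI hI' hne hI0 hf hg hF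
    refine ⟨Finsler.isRandersMetric_of_eq hε₁ hI0 hf hg hFa, fun x hx =>
      Finsler.not_isRiemannianAt_of_eq hε (hFa x hx), fun h3 => ?_, fun h2 => ?_, fun h1 => ?_⟩
    · refine key.trans (and_congr_right fun _ => ⟨?_, ?_⟩)
      · rintro (h | ⟨β, C, hgC, h | rfl | rfl⟩)
        · omega
        · omega
        · exact Or.inl ⟨β, fun ρ hρ => by rw [hgC ρ hρ]; ring⟩
        · refine Or.inr ⟨exp β, exp_pos β, fun ρ hρ => ?_⟩
          rw [hgC ρ hρ, Finsler.log_mul_zpow_eq (exp_pos β) (hI0 hρ), Real.log_exp]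
      · rintro (⟨β, hβ⟩ | ⟨B, hB, hgB⟩)
        · exact Or.inr ⟨β, 0, fun ρ hρ => by rw [hβ ρ hρ]; ring, Or.inr (Or.inl rfl)⟩
        · exact Or.inr ⟨log B, -4, fun ρ hρ => by
            rw [hgB ρ hρ, Finsler.log_mul_zpow_eq hB (hI0 hρ)], Or.inr (Or.inr rfl)⟩
    · refine key.trans (and_congr_right fun _ => ⟨?_, ?_⟩)
      · rintro (h | ⟨β, C, hgC, _⟩)
        · omega
        · refine ⟨exp β, C, exp_pos β, fun ρ hρ => ?_⟩
          rw [hgC ρ hρ, Finsler.log_mul_rpow_eq (exp_pos β) (hI0 hρ), Real.log_exp]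
      · rintro ⟨B, C, hB, hgB⟩
        exact Or.inr ⟨log B, C, fun ρ hρ => by
          rw [hgB ρ hρ, Finsler.log_mul_rpow_eq hB (hI0 hρ)], Or.inl h2⟩
    · exact key.trans (and_iff_left (Or.inl h1))
  · refine Finsler.isNonRiemannianRicciFlatSolution hn hε hε₁ hA (g := fun _ => log B)
      contDiffOn_const (fun z ρ _ => ?_)
      (Or.inr ⟨log B, 0, fun ρ _ => by ring, Or.inr (Or.inl rfl)⟩)
    rw [Real.exp_log hB]
  · refine Finsler.isNonRiemannianRicciFlatSolution hn hε hε₁ hA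
      (g := fun ρ => log B + -4 * log ρ) ?_ (fun z ρ hρ => ?_)
      (Or.inr ⟨log B, -4, fun ρ _ => rfl, Or.inr (Or.inr rfl)⟩)
    · exact contDiffOn_const.add (contDiffOn_const.mul
        (contDiffOn_id.log fun ρ hρ => (Set.mem_Ioi.mp hρ).ne'))
    · rw [← Finsler.log_mul_zpow_eq hB hρ, Real.exp_log (mul_pos hB (zpow_pos hρ _))]
  · refine Finsler.isNonRiemannianRicciFlatSolution hn hε hε₁ hA
      (g := fun ρ => log B + C * log ρ) ?_ (fun z ρ hρ => ?_)
      (Or.inr ⟨log B, C, fun ρ _ => rfl, Or.inl h2⟩)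
    · exact contDiffOn_const.add (contDiffOn_const.mul
        (contDiffOn_id.log fun ρ hρ => (Set.mem_Ioi.mp hρ).ne'))
    · rw [← Finsler.log_mul_rpow_eq hB hρ, Real.exp_log (mul_pos hB (Real.rpow_pos_of_pos hρ _))]
  · exact Finsler.isNonRiemannianRicciFlatSolution hn hε hε₁ hA hg (fun _ _ _ => rfl) (Or.inl h1)
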